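/- Let $\mathbf R=\{(t,x^1,x^2,x^3)\in\mathbb R^4: t\ge 0,\ x^1\le 0\}$ with $x^0=t$, $\partial_\alpha=\partial_{x^\alpha}$, and let $g_0=-dt^2+\sum_i (dx^i)^2$. Put $\mathcal C=\{x^1=0\}$, $S_t=\{x^0=t\}$, $\Sigma_t=S_t\cap\mathcal C$ (all inside $\mathbf R$) and $\mathcal C_t=\bigcup_{0\le t'\le t}\Sigma_{t'}$. For an integer $s\geq 0$, $\|\cdot\|_{H^s(\mathcal C_t)}$ is the Sobolev norm built from the derivatives of order at most $s$ tangent to $\mathcal C$ (in $t,x^2,x^3$), while $\|\cdot\|_{\bar H^s(S_t)}$ and $\|\cdot\|_{\bar H^s(\mathcal C_t)}$ are the $L^2$ norms over $S_t$, resp. $\mathcal C_t$, of all space-time derivatives of order at most $s$. For a tensor or a family of functions the squared norms of the components are added. Norms may be $+\infty$. Let $h=(h_{\alpha\beta})$ be a symmetric 2-tensor field on $\mathbf R$, smooth up to the boundary, with $$\Box_{g_0}h_{\alpha\beta}=0 \ \text{ in } \mathbf R,\qquad V'_h=0\ \text{ on }\{t=0\}\text{ and on }\mathcal C, \tag{1}$$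 where $V'_h=\frac{d}{d\varepsilon}\big|_{\varepsilon=0}V_{g_0+\varepsilon h}$ is the linearization at $g_0$ of the gauge field $V_g=(\Box_g x^\alpha)\partial_\alpha$, and with $$h_{22}-h_{33}=c_2,\quad h_{23}=c_3,\quad \tfrac12h_{00}+h_{10}=b_0,\quad h_{0A}+h_{1A}=b_A\ (A=2,3)\quad\text{on }\mathcal C. \tag{2}$$ **(Proposition 3.3)** Let $s>\frac52$ be an integer and $T>0$. There are constants $c,C>0$, depending only on $s$ and $T$, such that for every $h$ satisfying (1), (2) and $$h_{01}+\tfrac12h_{11}=b_1\quad\text{on }\mathcal C,$$ and every $t\in[0,T]$, $$\|h\|^2_{\bar H^s(S_t)}+c\,\|h\|^2_{\bar H^s(\mathcal C_t)}\le C\Big[\|h\|^2_{\bar H^s(S_0)}+\sum_{\mu=0}^3\|b_\mu\|^2_{H^s(\mathcal C_t)}+\sum_{A=2,3}\|c_A\|^2_{H^s(\mathcal C_t)}\Big].$$ **(Proposition 3.4)** For a Lorentz metric $g$ near $g_0$ let $K_{g|S_t}$ and $K_{g|\mathcal C}$ be the second fundamental forms of $S_t$ (future unit normal) and of $\mathcal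 C$ (outward unit normal), let $\mathrm{tr}_{\mathcal C}$, $\mathrm{tr}_{\Sigma_t}$ be the traces over the tangent spaces of $\mathcal C$, $\Sigma_t$ with respect to the metrics induced by $g$, and for $\alpha,\beta\in\mathbb R$ set $$H_g=\alpha\,\mathrm{tr}_{\Sigma_t}K_{g|S_t}-(\alpha+\beta+1)\,\mathrm{tr}_{\mathcal C}K_{g|\mathcal C}+(\alpha+1)\,\mathrm{tr}_{\Sigma_t}K_{g|\mathcal C},$$ with linearization $H'_h=\frac{d}{d\varepsilon}\big|_{\varepsilon=0}H_{g_0+\varepsilon h}$ at $g_0$. Suppose $$\alpha+1\ge0,\qquad 2\beta-1>0,\qquad(\alpha+1)^2\ge 2\beta-1.$$ Let $s>\frac52$ be an integer and $T>0$. There are constants $c,C>0$, depending only on $s,T,\alpha,\beta$, such that for every $h$ satisfying (1), (2) and $$H'_h=H'\quad\text{on }\mathcal C,$$ and every $t\in[0,T]$, $$\|h\|^2_{\bar H^s(S_t)}+c\,\|h\|^2_{\bar H^s(\mathcal C_t)}\le C\Big[\|h\|^2_{\bar H^s(S_0)}+\|H'\|^2_{H^{s-1}(\mathcal C_t)}+\sum_{\mu=0,2,3}\|b_\mu\|^2_{H^s(\mathcal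 C_t)}+\sum_{A=2,3}\|c_A\|^2_{H^s(\mathcal C_t)}\Big].$$ -/

import Mathlib

open scoped NNReal ENNReal ContDiff

noncomputable section

namespace CornerIBVP

/-- `ℝⁿ` with its Lebesgue measure. Only partial derivatives and Lebesgue integrals are used on it,
so the choice of norm plays no role. On `ℝ⁴` the coordinates are `(t, x¹, x², x³)`. -/
abbrev Coord (n : ℕ) : Type := Fin n → ℝ

/-- A field of `4 × 4` matrices on `ℝ⁴` (components of a metric or of a metric perturbation). -/
abbrev MatField : Type := Coord 4 → Matrix (Fin 4) (Fin 4) ℝ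

/-- The partial derivative `∂_i u`. -/
def pd {n : ℕ} (i : Fin n) (u : Coord n → ℝ) : Coord n → ℝ :=
  fun x => fderiv ℝ u x (Pi.single i 1)

/-- The sum of the squares of all partial derivatives of `u` of order at most `s`, at a point:
`∑_{k ≤ s} ∑_{i₁, …, i_k} (∂_{i₁} ⋯ ∂_{i_k} u)²`. For `s = 1` this is `u² + ∑_i (∂_i u)²`. -/
def jetSq {n : ℕ} : ℕ → (Coord n → ℝ) → Coord n → ℝ
  | 0, u, x => u x ^ 2
  | s + 1, u, x => u x ^ 2 + ∑ i, jetSq s (pd i u) x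

/-! ### The corner domain and the Sobolev norms -/

/-- The corner domain `{t ≥ 0, x¹ ≤ 0}`. -/
def corner : Set (Coord 4) := {x | 0 ≤ x 0 ∧ x 1 ≤ 0}

/-- The point `(t, x¹, x², x³)` of the slice `S_t`, with `z = (x¹, x², x³)`. -/
def slicePt (t : ℝ) (z : Coord 3) : Coord 4 := ![t, z 0, z 1, z 2]

/-- The point `(t, 0, x², x³)` of the hypersurface `{x¹ = 0}`, with `y = (t, x², x³)`. -/
def sidePt (y : Coord 3) : Coord 4 := ![y 0, 0, y 1, y 2]

/-- The lateral boundary up to time `t`, in the coordinates `(t, x², x³)`. -/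
def sideUpTo (t : ℝ) : Set (Coord 3) := {y | 0 ≤ y 0 ∧ y 0 ≤ t}

/-- Squared norm on `S_t = {t} × {x¹ ≤ 0}` with all space-time derivatives up to order `s`. -/
def barNormSqSlice (s : ℕ) (t : ℝ) (u : Coord 4 → ℝ) : ℝ≥0∞ :=
  ∫⁻ z in {z : Coord 3 | z 0 ≤ 0}, ENNReal.ofReal (jetSq s u (slicePt t z))

/-- Squared norm on `𝒞_t = {0 ≤ time ≤ t, x¹ = 0}` with all space-time derivatives
(also the normal ones) up to order `s`. -/
def barNormSqSide (s : ℕ) (t : ℝ) (u : Coord 4 → ℝ) : ℝ≥0∞ :=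
  ∫⁻ y in sideUpTo t, ENNReal.ofReal (jetSq s u (sidePt y))

/-- Squared `H^s(𝒞_t)` norm of a function of `(t, x², x³)`: tangential derivatives only. -/
def normSqSide (s : ℕ) (t : ℝ) (b : Coord 3 → ℝ) : ℝ≥0∞ :=
  ∫⁻ y in sideUpTo t, ENNReal.ofReal (jetSq s b y)

/-! ### Metrics, the gauge field and the mean curvatures -/

/-- The Minkowski metric `diag(-1, 1, 1, 1)`. -/
def minkowski : Matrix (Fin 4) (Fin 4) ℝ := Matrix.diagonal ![-1, 1, 1, 1]

/-- The wave operator `-∂_t² + ∂_1² + ∂_2² + ∂_3²` of the Minkowski metric. -/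
def flatBox (u : Coord 4 → ℝ) (x : Coord 4) : ℝ :=
  -pd 0 (pd 0 u) x + pd 1 (pd 1 u) x + pd 2 (pd 2 u) x + pd 3 (pd 3 u) x

/-- The Christoffel symbol `Γ^l_{ij}` of the metric `g`. -/
def christoffel (g : MatField) (l i j : Fin 4) (x : Coord 4) : ℝ :=
  (1 / 2) * ∑ m, (g x)⁻¹ l m *
    (pd i (fun y => g y m j) x + pd j (fun y => g y m i) x - pd m (fun y => g y i j) x)

/-- The wave operator of `g`, i.e. the trace of the covariant Hessian. -/
def box (g : MatField) (u : Coord 4 → ℝ) (x : Coord 4) : ℝ :=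
  ∑ i, ∑ j, (g x)⁻¹ i j * (pd i (pd j u) x - ∑ l, christoffel g l i j x * pd l u x)

/-- The component `V_g^a = □_g x^a` of the gauge field. -/
def gaugeField (a : Fin 4) (g : MatField) (x : Coord 4) : ℝ :=
  box g (fun y => y a) x

/-- Second fundamental form `K(∂_i, ∂_j) = -g(∇_{∂_i} ∂_j, T)` of the level sets of `t`, for
`i, j ≠ 0`, with respect to the future unit normal `T`, whose covector is `-dt / √(-g^{00})`. -/
def secondFormTime (g : MatField) (x : Coord 4) : Matrix (Fin 4) (Fin 4) ℝ :=
  fun i j => christoffel g 0 i j x / √(-(g x)⁻¹ 0 0)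

/-- Second fundamental form `K(∂_i, ∂_j) = -g(∇_{∂_i} ∂_j, ν)` of the level sets of `x¹`, for
`i, j ≠ 1`, with respect to the outward unit normal `ν`, whose covector is `dx¹ / √(g^{11})`. -/
def secondFormSide (g : MatField) (x : Coord 4) : Matrix (Fin 4) (Fin 4) ℝ :=
  fun i j => -christoffel g 1 i j x / √((g x)⁻¹ 1 1)

/-- The trace of a bilinear form `K` restricted to the span of the coordinate directions listed
by `e`, with respect to the restriction of the bilinear form `G` to this span. -/
def traceOn {m : ℕ} (e : Fin m → Fin 4) (G K : Matrix (Fin 4) (Fin 4) ℝ) : ℝ :=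
  ∑ i, ∑ j, (G.submatrix e e)⁻¹ i j * K (e i) (e j)

/-- The combination of mean curvatures
`α tr_{Σ_t} K_{g|S_t} - (α + β + 1) tr_𝒞 K_{g|𝒞} + (α + 1) tr_{Σ_t} K_{g|𝒞}`. -/
def meanCurv (α β : ℝ) (g : MatField) (x : Coord 4) : ℝ :=
  α * traceOn ![2, 3] (g x) (secondFormTime g x)
    - (α + β + 1) * traceOn ![0, 2, 3] (g x) (secondFormSide g x)
    + (α + 1) * traceOn ![2, 3] (g x) (secondFormSide g x)

/-- The linearization at the Minkowski metric, in the direction `h`, of a scalar `Q` built from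
the metric: `d/dε Q(η + ε h)` at `ε = 0`. -/
def linearization (Q : MatField → Coord 4 → ℝ) (h : MatField) (x : Coord 4) : ℝ :=
  deriv (fun ε : ℝ => Q (fun y => minkowski + ε • h y) x) 0

/-! ### The linear systems for the metric perturbation -/

/-- The part common to both linearized systems: `h` is a symmetric 2-tensor field, smooth up to
the boundary of the corner domain (that is, it extends smoothly across it), each component solves
the wave equation in the corner domain, and the linearized gauge field `V'_h` vanishes on
`{t = 0}` and on `{x¹ = 0}`. -/
structure IsGaugedWave (h : MatField) : Prop where
  smooth : ∀ i j, ContDiff ℝ ∞ (fun x => h x i j)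
  symm : ∀ x, (h x).IsSymm
  wave : ∀ i j, ∀ x ∈ corner, flatBox (fun y => h y i j) x = 0
  gauge_initial : ∀ a, ∀ x ∈ corner, x 0 = 0 → linearization (gaugeField a) h x = 0
  gauge_side : ∀ a, ∀ x ∈ corner, x 1 = 0 → linearization (gaugeField a) h x = 0

/-- The boundary conditions shared by both systems, with data given as functions of
`(t, x², x³)`, `t ≥ 0`. -/
structure HasCommonData (h : MatField) (b₀ b₂ b₃ c₂ c₃ : Coord 3 → ℝ) : Prop where
  eq_c₂ : ∀ y : Coord 3, 0 ≤ y 0 → h (sidePt y) 2 2 - h (sidePt y) 3 3 = c₂ y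
  eq_c₃ : ∀ y : Coord 3, 0 ≤ y 0 → h (sidePt y) 2 3 = c₃ y
  eq_b₀ : ∀ y : Coord 3, 0 ≤ y 0 → (1 / 2) * h (sidePt y) 0 0 + h (sidePt y) 1 0 = b₀ y
  eq_b₂ : ∀ y : Coord 3, 0 ≤ y 0 → h (sidePt y) 0 2 + h (sidePt y) 1 2 = b₂ y
  eq_b₃ : ∀ y : Coord 3, 0 ≤ y 0 → h (sidePt y) 0 3 + h (sidePt y) 1 3 = b₃ y

/-- The system with Dirichlet, conformal and gauge boundary conditions. -/
structure IsDirichletSolution (h : MatField) (b₀ b₁ b₂ b₃ c₂ c₃ : Coord 3 → ℝ) : Prop where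
  gauged : IsGaugedWave h
  common : HasCommonData h b₀ b₂ b₃ c₂ c₃
  eq_b₁ : ∀ y : Coord 3, 0 ≤ y 0 → h (sidePt y) 0 1 + (1 / 2) * h (sidePt y) 1 1 = b₁ y

/-- The system in which the condition on `h_{01} + h_{11} / 2` is replaced by a condition on the
linearized mean curvature combination. -/
structure IsMeanCurvSolution (α β : ℝ) (h : MatField)
    (H b₀ b₂ b₃ c₂ c₃ : Coord 3 → ℝ) : Prop where
  gauged : IsGaugedWave h
  common : HasCommonData h b₀ b₂ b₃ c₂ c₃
  eq_H : ∀ y : Coord 3, 0 ≤ y 0 → linearization (meanCurv α β) h (sidePt y) = H y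

end CornerIBVP

end

/-! Everything rests on one scalar energy inequality. For a solution `u` of the flat wave equation
in the corner, the multiplier `∂_t + δ ∂_1` with `|δ| ≤ 1/2` has an energy on slices that dominates
the full gradient. Its flux through `{x¹ = 0}` is a quadratic form in the gradient which, for a
suitable `δ`, is negative definite up to terms given by the boundary data: the tangential
derivatives of `u` (Dirichlet, `δ = -1/2`) or `∂_0 u + r ∂_1 u` with `r > 0` (Sommerfeld, `δ = r /
(1 + 2 r²)`). Hence all first derivatives, the normal one included, are bounded on slices and on the
side. Differentiating tangentially and solving the wave equation for `∂_1² u` gives every order: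
`mem_controlled_of_dirichlet` and `mem_controlled_of_sommerfeld`. The second gains one derivative
over its boundary data.

Constants must be uniform in `h` and norms may be infinite. Estimates are therefore phrased as
membership of families of functions, indexed by all solutions, in submodules such as `controlled`.
These are closed under linear combinations and a derivative lowers their order by one, so the
treatment of the systems becomes linear algebra with constant coefficient operators.

The five common boundary conditions are Dirichlet data for five scalar waves. If `h_01 + h_11 / 2`
is given too, the gauge equations with index 2, 3 become Sommerfeld conditions for `h_12`, `h_13`.
Those with index 0, 1 become, modulo known terms, `∂_0 (q, w) = -M ∂_1 (q, w)` with `q = h_01`, `w =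
(h_22 + h_33) / 2` and `M` with rows `(2, 1)`, `(3, 2)`. The eigenvalues `2 ± √3` are positive, so
the two eigencombinations satisfy Sommerfeld conditions.

In the mean curvature problem the linearized gauge field and `H'_h` are themselves waves with
Dirichlet data, so their normal derivatives are controlled as well. Elimination
(`third_order_identity`) then leaves, for `p = h_11 / 2`, a known boundary value of `(∂_0 +
∂_1)(∂_0² + 2(α+1) ∂_0 ∂_1 + (2β-1) ∂_1²) p`. The conditions on `α`, `β` say that the quadratic
factor splits as `(∂_0 + r₁ ∂_1)(∂_0 + r₂ ∂_1)` with `r₁, r₂ > 0`. Three Sommerfeld estimates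
recover the three derivatives, and the other components follow by back substitution. -/

noncomputable section

namespace CornerIBVP

open MeasureTheory Set Filter Topology

/-! ### Partial derivatives -/

section PartialDerivatives

variable {n : ℕ} {i : Fin n} {f g : Coord n → ℝ} {x : Coord n}

lemma pd_add (hf : DifferentiableAt ℝ f x) (hg : DifferentiableAt ℝ g x) :
    pd i (fun y => f y + g y) x = pd i f x + pd i g x := by
  simp only [pd]
  rw [fderiv_fun_add hf hg]; rfl

lemma pd_sub (hf : DifferentiableAt ℝ f x) (hg : DifferentiableAt ℝ g x) :
    pd i (fun y => f y - g y) x = pd i f x - pd i g x := by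
  simp only [pd]
  rw [fderiv_fun_sub hf hg]; rfl

lemma pd_mul (hf : DifferentiableAt ℝ f x) (hg : DifferentiableAt ℝ g x) :
    pd i (fun y => f y * g y) x = pd i f x * g x + f x * pd i g x := by
  simp only [pd]
  rw [fderiv_fun_mul hf hg]
  simp only [FunLike.coe_add, Pi.add_apply, FunLike.coe_smul, Pi.smul_apply, smul_eq_mul]
  ring

lemma pd_sq (hf : DifferentiableAt ℝ f x) :
    pd i (fun y => f y ^ 2) x = 2 * f x * pd i f x := by
  simp only [pow_two]
  rw [pd_mul hf hf]; ring

lemma pd_const (c : ℝ) : pd i (fun _ : Coord n => c) x = 0 := by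
  simp [pd]

lemma pd_const_mul (c : ℝ) (hf : DifferentiableAt ℝ f x) :
    pd i (fun y => c * f y) x = c * pd i f x := by
  rw [pd_mul (by fun_prop) hf, pd_const]; ring

lemma pd_coord (i j : Fin n) (x : Coord n) :
    pd i (fun y => y j) x = if j = i then 1 else 0 := by
  simp only [pd]
  rw [(hasFDerivAt_apply (𝕜 := ℝ) j x).fderiv]
  simp [Pi.single_apply]

lemma pd_comp {φ : ℝ → ℝ} {a : ℝ} (hφ : HasDerivAt φ a (f x)) (hf : DifferentiableAt ℝ f x) :
    pd i (fun y => φ (f y)) x = a * pd i f x := by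
  simp only [pd]
  have h := (hφ.comp_hasFDerivAt x hf.hasFDerivAt).fderiv
  simp only [Function.comp_def] at h
  rw [h]; simp

lemma smooth_pd (hf : ContDiff ℝ ∞ f) (i : Fin n) : ContDiff ℝ ∞ (pd i f) := by
  unfold CornerIBVP.pd
  exact (hf.fderiv_right (m := ∞) (by simp)).clm_apply contDiff_const

lemma pd_comm (hf : ContDiff ℝ ∞ f) (i j : Fin n) : pd i (pd j f) = pd j (pd i f) := by
  funext x
  have key : ∀ i j : Fin n, pd i (pd j f) x
      = fderiv ℝ (fderiv ℝ f) x (Pi.single i 1) (Pi.single j 1) := by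
    intro i j
    have hd : DifferentiableAt ℝ (fderiv ℝ f) x :=
      ((hf.fderiv_right (m := ∞) (by simp)).differentiable (by simp)) x
    change fderiv ℝ (fun y => fderiv ℝ f y (Pi.single j 1)) x (Pi.single i 1) = _
    rw [fderiv_clm_apply hd (by fun_prop)]
    simp
  rw [key, key]
  exact (hf.contDiffAt.isSymmSndFDerivAt (by simpa using WithTop.coe_le_coe.2 (le_top : (2 : ℕ∞) ≤ ⊤))).eq _ _

lemma pd_congr_of_eventuallyEq (h : f =ᶠ[𝓝 x] g) : pd i f x = pd i g x := by
  simp only [pd, h.fderiv_eq]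

lemma pd_continuous (hf : ContDiff ℝ 1 f) : Continuous (pd i f) := by
  unfold CornerIBVP.pd
  exact (hf.continuous_fderiv (by simp)).clm_apply continuous_const

end PartialDerivatives

/-! ### The two faces of the corner -/

lemma slicePt_eq (t : ℝ) (z : Coord 3) : slicePt t z = Fin.insertNth (0 : Fin 4) t z := by
  funext i; fin_cases i <;> rfl

lemma sidePt_eq (y : Coord 3) : sidePt y = Fin.insertNth (1 : Fin 4) (0 : ℝ) y := by
  funext i; fin_cases i <;> rfl

lemma continuous_slicePt (t : ℝ) : Continuous (slicePt t) := by
  refine continuous_pi fun i => ?_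
  fin_cases i <;> simp [slicePt] <;> fun_prop

/-- The embedding `sidePt` as a linear map. -/
def sideLin : Coord 3 →L[ℝ] Coord 4 :=
  ContinuousLinearMap.pi ![.proj 0, 0, .proj 1, .proj 2]

lemma sideLin_apply (y : Coord 3) : sideLin y = sidePt y := by
  funext i; fin_cases i <;> rfl

lemma continuous_sidePt : Continuous sidePt := by
  simpa only [← funext sideLin_apply] using sideLin.continuous

/-- The index in `ℝ⁴` of a tangential direction of the side. -/
def sideIdx : Fin 3 → Fin 4 := ![0, 2, 3]

lemma pd_comp_sidePt {f : Coord 4 → ℝ} (hf : Differentiable ℝ f) (j : Fin 3) (y : Coord 3) :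
    pd j (fun y => f (sidePt y)) y = pd (sideIdx j) f (sidePt y) := by
  have h1 : HasFDerivAt (fun y => f (sidePt y)) ((fderiv ℝ f (sidePt y)).comp sideLin) y := by
    have := (hf (sideLin y)).hasFDerivAt.comp y sideLin.hasFDerivAt
    simpa only [Function.comp_def, sideLin_apply] using this
  simp only [pd, h1.fderiv, ContinuousLinearMap.comp_apply]
  congr 1
  rw [sideLin_apply]
  funext i
  fin_cases j <;> fin_cases i <;> simp [sidePt, sideIdx]

/-- The weight `max(0, r)²`, which is continuously differentiable. -/
lemma hasDerivAt_sq_max_zero (r : ℝ) :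
    HasDerivAt (fun r : ℝ => max 0 r ^ 2) (2 * max 0 r) r := by
  rcases lt_trichotomy r 0 with h | h | h
  · rw [max_eq_left h.le, mul_zero]
    refine (hasDerivAt_const r (0 : ℝ)).congr_of_eventuallyEq ?_
    filter_upwards [gt_mem_nhds h] with s hs
    simp [max_eq_left (le_of_lt hs)]
  · subst h
    rw [max_self, mul_zero, hasDerivAt_iff_isLittleO_nhds_zero]
    simp only [zero_add, max_self, smul_zero, sub_zero]
    have h1 : (fun s : ℝ => s ^ 2) =o[𝓝 0] fun s => s := by
      simpa using Asymptotics.isLittleO_pow_id (𝕜 := ℝ) (n := 2) (by norm_num)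
    refine Asymptotics.IsBigO.trans_isLittleO (Asymptotics.IsBigO.of_bound 1 ?_) h1
    refine Eventually.of_forall fun s => ?_
    rcases le_total 0 s with hs | hs <;> simp [hs]
    positivity
  · rw [max_eq_right h.le]
    refine (by simpa using hasDerivAt_pow 2 r : HasDerivAt (fun r : ℝ => r ^ 2) (2 * r) r).congr_of_eventuallyEq ?_
    filter_upwards [lt_mem_nhds h] with s hs
    simp [max_eq_right (le_of_lt hs)]

/-- The square makes the cutoff `C¹`, the regularity that the divergence theorem is applied with
below. -/
lemma contDiff_sq_max_zero : ContDiff ℝ 1 (fun r : ℝ => max 0 r ^ 2) := by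
  rw [contDiff_one_iff_deriv]
  refine ⟨fun r => (hasDerivAt_sq_max_zero r).differentiableAt, ?_⟩
  rw [funext fun r => (hasDerivAt_sq_max_zero r).deriv]
  fun_prop

/-- The divergence theorem on `[0, t] × [-R, 0] × [-R, R]²` for a field with nonpositive divergence
that vanishes on the faces away from the corner. -/
lemma boundary_flux_nonpos {t R : ℝ} (ht : 0 ≤ t) (hR : 0 < R) (f : Fin 4 → Coord 4 → ℝ)
    (hf : ∀ i, ContDiff ℝ 1 (f i))
    (hfar : ∀ i x, 0 ≤ x 0 → (∃ j, j ≠ 0 ∧ |x j| = R) → f i x = 0)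
    (hdiv : ∀ x ∈ corner, (∀ j, j ≠ 0 → |x j| ≤ R) →
      pd 0 (f 0) x + pd 1 (f 1) x + pd 2 (f 2) x + pd 3 (f 3) x ≤ 0) :
    (∫ z in Icc ![-R, -R, -R] ![0, R, R], f 0 (slicePt t z))
      + (∫ y in Icc ![0, -R, -R] ![t, R, R], f 1 (sidePt y))
      ≤ ∫ z in Icc ![-R, -R, -R] ![0, R, R], f 0 (slicePt 0 z) := by
  have hle : (![0, -R, -R, -R] : Coord 4) ≤ ![t, 0, R, R] := by
    intro i; fin_cases i <;> simp <;> linarith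
  have hcont : Continuous fun x => ∑ i : Fin 4, fderiv ℝ (f i) x (Pi.single i 1) := by
    refine continuous_finsetSum _ fun i _ => ?_
    exact pd_continuous (hf i)
  have key := integral_divergence_of_hasFDerivAt_off_countable' (E := ℝ) (n := 3)
    ![0, -R, -R, -R] ![t, 0, R, R] hle f (fun i x => fderiv ℝ (f i) x) ∅ countable_empty
    (fun i => (hf i).continuous.continuousOn)
    (fun x _ i => ((hf i).differentiable (by simp) x).hasFDerivAt)
    (hcont.continuousOn.integrableOn_compact isCompact_Icc)
  have hneg : (∫ x in Icc (![0, -R, -R, -R] : Coord 4) ![t, 0, R, R],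
      ∑ i : Fin 4, fderiv ℝ (f i) x (Pi.single i 1)) ≤ 0 := by
    refine setIntegral_nonpos measurableSet_Icc fun x hx => ?_
    have h0 := hx.1 0
    have h1 := hx.1 1
    have h2 := hx.1 2
    have h3 := hx.1 3
    have h1' := hx.2 1
    have h2' := hx.2 2
    have h3' := hx.2 3
    simp at h0 h1 h2 h3 h1' h2' h3'
    rw [Fin.sum_univ_four]
    refine hdiv x ⟨h0, h1'⟩ fun j hj => ?_
    fin_cases j
    · exact absurd rfl hj
    · exact abs_le.2 ⟨h1, by simp; linarith⟩
    · exact abs_le.2 ⟨h2, h2'⟩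
    · exact abs_le.2 ⟨h3, h3'⟩
  rw [key.trans (Fin.sum_univ_four _)] at hneg
  have e0 : (![0, -R, -R, -R] : Coord 4) ∘ (0 : Fin 4).succAbove = ![-R, -R, -R] := by
    funext i; fin_cases i <;> rfl
  have e0' : (![t, 0, R, R] : Coord 4) ∘ (0 : Fin 4).succAbove = ![0, R, R] := by
    funext i; fin_cases i <;> rfl
  have e1 : (![0, -R, -R, -R] : Coord 4) ∘ (1 : Fin 4).succAbove = ![0, -R, -R] := by
    funext i; fin_cases i <;> rfl
  have e1' : (![t, 0, R, R] : Coord 4) ∘ (1 : Fin 4).succAbove = ![t, R, R] := by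
    funext i; fin_cases i <;> rfl
  -- Of the six lateral faces only `x¹ = 0` survives: `x¹ = -R` and the four faces `|x^A| = R` lie
  -- where the field vanishes.
  have hz : ∀ (i : Fin 4) (r : ℝ), i ≠ 0 → |r| = R →
      ∫ x in Icc ((![0, -R, -R, -R] : Coord 4) ∘ i.succAbove) (![t, 0, R, R] ∘ i.succAbove),
        f i (Fin.insertNth i r x) = 0 := by
    intro i r hi hr
    refine setIntegral_eq_zero_of_forall_eq_zero fun x hx => ?_
    refine hfar i _ ?_ ⟨i, hi, by simpa using hr⟩
    have h0 := hx.1 0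
    fin_cases i
    · exact absurd rfl hi
    all_goals exact h0
  have hRabs : |R| = R := abs_of_pos hR
  have hRabs' : |-R| = R := by rw [abs_neg, hRabs]
  have z1 := hz 1 ((![0, -R, -R, -R] : Coord 4) 1) (by simp) hRabs'
  have z2 := hz 2 ((![0, -R, -R, -R] : Coord 4) 2) (by simp) hRabs'
  have z3 := hz 3 ((![0, -R, -R, -R] : Coord 4) 3) (by simp) hRabs'
  have z2' := hz 2 ((![t, 0, R, R] : Coord 4) 2) (by simp) hRabs
  have z3' := hz 3 ((![t, 0, R, R] : Coord 4) 3) (by simp) hRabs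
  rw [z1, z2, z3, z2', z3', e0, e0', e1, e1'] at hneg
  simp only [slicePt_eq, sidePt_eq]
  change _ + (∫ y in _, f 1 (Fin.insertNth 1 ((![t, 0, R, R] : Coord 4) 1) y))
    ≤ ∫ z in _, f 0 (Fin.insertNth 0 ((![0, -R, -R, -R] : Coord 4) 0) z)
  change (∫ z in _, f 0 (Fin.insertNth 0 ((![t, 0, R, R] : Coord 4) 0) z)) + _ ≤ _
  linarith

/-! ### The weighted energy inequality -/

/-- The sum of the squares of the first derivatives. -/
def gradSq (u : Coord 4 → ℝ) (x : Coord 4) : ℝ :=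
  pd 0 u x ^ 2 + pd 1 u x ^ 2 + pd 2 u x ^ 2 + pd 3 u x ^ 2

/-- The energy density of the multiplier `∂_t + δ ∂_1`, with a zeroth order term. -/
def energyDensity (δ : ℝ) (u : Coord 4 → ℝ) (x : Coord 4) : ℝ :=
  1 / 2 * (pd 0 u x ^ 2 + pd 1 u x ^ 2 + pd 2 u x ^ 2 + pd 3 u x ^ 2)
    + δ * (pd 0 u x * pd 1 u x) + u x ^ 2

/-- The flux of the multiplier `∂_t + δ ∂_1` through the side. -/
def normalFlux (δ : ℝ) (u : Coord 4 → ℝ) (x : Coord 4) : ℝ :=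
  pd 0 u x * pd 1 u x
    + δ / 2 * (pd 0 u x ^ 2 + pd 1 u x ^ 2 - pd 2 u x ^ 2 - pd 3 u x ^ 2)

/-- The flux of the multiplier `∂_t + δ ∂_1` in the direction `i` tangent to the side. -/
def tangentialFlux (δ : ℝ) (i : Fin 4) (u : Coord 4 → ℝ) (x : Coord 4) : ℝ :=
  pd 0 u x * pd i u x + δ * (pd 1 u x * pd i u x)

/-- The profile of the weight, positive inside a backward solid paraboloid. -/
def profile (R : ℝ) (x : Coord 4) : ℝ :=
  1 - 24 / R * x 0 - 1 / R ^ 2 * (x 1 ^ 2 + x 2 ^ 2 + x 3 ^ 2)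

/-- A compactly supported weight that decreases along the flux of the energy. -/
def weight (R : ℝ) (x : Coord 4) : ℝ :=
  Real.exp (-4 * x 0) * max 0 (profile R x) ^ 2

section Densities

variable {u : Coord 4 → ℝ} {δ : ℝ}

lemma gradSq_nonneg (u : Coord 4 → ℝ) (x : Coord 4) : 0 ≤ gradSq u x := by
  unfold gradSq; positivity

/-- For `|δ| ≤ 1/2` the cross term costs at most a quarter of `(∂_0 u)² + (∂_1 u)²`, half of what
the main term provides. -/
lemma le_energyDensity (hδ : |δ| ≤ 1 / 2) (x : Coord 4) :
    1 / 4 * gradSq u x + u x ^ 2 ≤ energyDensity δ u x := by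
  unfold gradSq energyDensity
  obtain ⟨h1, h2⟩ := abs_le.1 hδ
  nlinarith [mul_nonneg (by linarith : 0 ≤ 1 / 2 + δ) (sq_nonneg (pd 0 u x + pd 1 u x)),
    mul_nonneg (by linarith : 0 ≤ 1 / 2 - δ) (sq_nonneg (pd 0 u x - pd 1 u x)),
    sq_nonneg (pd 2 u x), sq_nonneg (pd 3 u x), sq_nonneg (u x)]

lemma energyDensity_le (hδ : |δ| ≤ 1 / 2) (x : Coord 4) :
    energyDensity δ u x ≤ gradSq u x + u x ^ 2 := by
  unfold gradSq energyDensity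
  obtain ⟨h1, h2⟩ := abs_le.1 hδ
  nlinarith [mul_nonneg (by linarith : 0 ≤ 1 / 2 - δ) (sq_nonneg (pd 0 u x + pd 1 u x)),
    mul_nonneg (by linarith : 0 ≤ 1 / 2 + δ) (sq_nonneg (pd 0 u x - pd 1 u x)),
    sq_nonneg (pd 2 u x), sq_nonneg (pd 3 u x), sq_nonneg (u x)]

lemma abs_normalFlux_le (hδ : |δ| ≤ 1 / 2) (x : Coord 4) :
    |normalFlux δ u x| ≤ gradSq u x := by
  unfold gradSq normalFlux
  obtain ⟨h1, h2⟩ := abs_le.1 hδ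
  rw [abs_le]
  constructor <;> nlinarith [mul_nonneg (by linarith : 0 ≤ 1 / 2 - δ) (sq_nonneg (pd 0 u x)),
    mul_nonneg (by linarith : 0 ≤ 1 / 2 + δ) (sq_nonneg (pd 0 u x)),
    mul_nonneg (by linarith : 0 ≤ 1 / 2 - δ) (sq_nonneg (pd 1 u x)),
    mul_nonneg (by linarith : 0 ≤ 1 / 2 + δ) (sq_nonneg (pd 1 u x)),
    mul_nonneg (by linarith : 0 ≤ 1 / 2 - δ) (sq_nonneg (pd 2 u x)),
    mul_nonneg (by linarith : 0 ≤ 1 / 2 + δ) (sq_nonneg (pd 2 u x)),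
    mul_nonneg (by linarith : 0 ≤ 1 / 2 - δ) (sq_nonneg (pd 3 u x)),
    mul_nonneg (by linarith : 0 ≤ 1 / 2 + δ) (sq_nonneg (pd 3 u x)),
    sq_nonneg (pd 0 u x + pd 1 u x), sq_nonneg (pd 0 u x - pd 1 u x),
    sq_nonneg (pd 0 u x), sq_nonneg (pd 1 u x), sq_nonneg (pd 2 u x), sq_nonneg (pd 3 u x)]

lemma abs_tangentialFlux_le (hδ : |δ| ≤ 1 / 2) {i : Fin 4} (hi : i = 2 ∨ i = 3) (x : Coord 4) :
    |tangentialFlux δ i u x| ≤ gradSq u x := by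
  have hle : pd 0 u x ^ 2 + pd 1 u x ^ 2 + pd i u x ^ 2 ≤ gradSq u x := by
    unfold gradSq
    rcases hi with rfl | rfl <;> nlinarith [sq_nonneg (pd 2 u x), sq_nonneg (pd 3 u x)]
  refine le_trans ?_ hle
  unfold tangentialFlux
  obtain ⟨h1, h2⟩ := abs_le.1 hδ
  generalize pd 0 u x = a
  generalize pd 1 u x = b
  generalize pd i u x = d
  have h3 : |δ * (b * d)| ≤ 1 / 2 * |b * d| := by
    rw [abs_mul]; gcongr
  have h4 : |a * d| ≤ 1 / 2 * (a ^ 2 + d ^ 2) := by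
    rw [abs_le]; constructor <;> nlinarith [sq_nonneg (a + d), sq_nonneg (a - d)]
  have h5 : |b * d| ≤ 1 / 2 * (b ^ 2 + d ^ 2) := by
    rw [abs_le]; constructor <;> nlinarith [sq_nonneg (b + d), sq_nonneg (b - d)]
  have h6 := abs_add_le (a * d) (δ * (b * d))
  nlinarith [sq_nonneg a, sq_nonneg b, sq_nonneg d]

lemma contDiff_profile (R : ℝ) : ContDiff ℝ ∞ (profile R) := by
  unfold profile; fun_prop

lemma contDiff_weight (R : ℝ) : ContDiff ℝ 1 (weight R) := by
  unfold weight
  exact ContDiff.mul (by fun_prop)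
    (contDiff_sq_max_zero.comp ((contDiff_profile R).of_le (by simp)))

lemma pd_profile_zero (R : ℝ) (x : Coord 4) : pd 0 (profile R) x = -(24 / R) := by
  unfold profile
  simp (disch := fun_prop) only [pd_sub, pd_add, pd_const_mul, pd_sq, pd_const, pd_coord]
  simp

lemma pd_profile (R : ℝ) (x : Coord 4) {i : Fin 4} (hi : i ≠ 0) :
    pd i (profile R) x = -(2 * x i / R ^ 2) := by
  unfold profile
  simp (disch := fun_prop) only [pd_sub, pd_add, pd_const_mul, pd_sq, pd_const, pd_coord]
  fin_cases i
  · exact absurd rfl hi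
  all_goals simp; ring

lemma pd_weight (R : ℝ) (x : Coord 4) (i : Fin 4) :
    pd i (weight R) x = (if i = 0 then -4 else 0) * weight R x
      + Real.exp (-4 * x 0) * (2 * max 0 (profile R x) * pd i (profile R) x) := by
  have hp : DifferentiableAt ℝ (profile R) x :=
    ((contDiff_profile R).differentiable (by simp)) x
  have h1 : pd i (fun y => max 0 (profile R y) ^ 2) x = 2 * max 0 (profile R x) * pd i (profile R) x :=
    pd_comp (hasDerivAt_sq_max_zero _) hp
  have h2 : pd i (fun y : Coord 4 => Real.exp (-4 * y 0)) x
      = Real.exp (-4 * x 0) * pd i (fun y => -4 * y 0) x :=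
    pd_comp (f := fun y => -4 * y 0) (Real.hasDerivAt_exp _) (by fun_prop)
  have hd : DifferentiableAt ℝ (fun y => max 0 (profile R y) ^ 2) x :=
    (hasDerivAt_sq_max_zero _).differentiableAt.comp x hp
  unfold weight
  rw [pd_mul (by fun_prop) hd, h1, h2, pd_const_mul _ (by fun_prop), pd_coord]
  by_cases hi : i = 0
  · simp [hi]; ring
  · simp [hi, Ne.symm hi]

lemma weight_nonneg (R : ℝ) (x : Coord 4) : 0 ≤ weight R x := by
  unfold weight; positivity

lemma profile_le_one {R : ℝ} (hR : 0 < R) {x : Coord 4} (hx : 0 ≤ x 0) : profile R x ≤ 1 := by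
  unfold profile
  have h1 : 0 ≤ 24 / R * x 0 := by positivity
  have h2 : 0 ≤ 1 / R ^ 2 * (x 1 ^ 2 + x 2 ^ 2 + x 3 ^ 2) := by positivity
  linarith

lemma weight_le_one {R : ℝ} (hR : 0 < R) {x : Coord 4} (hx : 0 ≤ x 0) : weight R x ≤ 1 := by
  unfold weight
  have h1 : max 0 (profile R x) ≤ 1 := max_le zero_le_one (profile_le_one hR hx)
  have h2 : Real.exp (-4 * x 0) ≤ 1 := Real.exp_le_one_iff.2 (by linarith)
  have h3 : max 0 (profile R x) ^ 2 ≤ 1 := pow_le_one₀ (le_max_left _ _) h1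
  exact mul_le_one₀ h2 (by positivity) h3

lemma profile_nonpos {R : ℝ} (hR : 0 < R) {x : Coord 4} (hx : 0 ≤ x 0) {j : Fin 4} (hj : j ≠ 0)
    (hxj : R ≤ |x j|) : profile R x ≤ 0 := by
  have h1 : 0 ≤ 24 / R * x 0 := by positivity
  have h2 : R ^ 2 ≤ x j ^ 2 := by rw [← sq_abs (x j)]; gcongr
  have h3 : x j ^ 2 ≤ x 1 ^ 2 + x 2 ^ 2 + x 3 ^ 2 := by
    fin_cases j
    · exact absurd rfl hj
    all_goals simp; nlinarith [sq_nonneg (x 1), sq_nonneg (x 2), sq_nonneg (x 3)]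
  have h4 : 1 ≤ 1 / R ^ 2 * (x 1 ^ 2 + x 2 ^ 2 + x 3 ^ 2) := by
    rw [one_div_mul_eq_div, le_div_iff₀ (by positivity)]; linarith
  unfold profile
  linarith

lemma weight_eq_zero {R : ℝ} (hR : 0 < R) {x : Coord 4} (hx : 0 ≤ x 0) {j : Fin 4} (hj : j ≠ 0)
    (hxj : R ≤ |x j|) : weight R x = 0 := by
  simp [weight, max_eq_left (profile_nonpos hR hx hj hxj)]

/-- Both slopes of the profile, `24 / R` and `1 / R²`, tend to zero, so the spatial cutoff
disappears in the limit and only the time weight remains. -/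
lemma tendsto_weight (x : Coord 4) :
    Tendsto (fun n : ℕ => weight (n + 1) x) atTop (𝓝 (Real.exp (-4 * x 0))) := by
  have h0 : Tendsto (fun n : ℕ => 1 / ((n : ℝ) + 1)) atTop (𝓝 0) :=
    tendsto_one_div_add_atTop_nhds_zero_nat
  have h1 : Tendsto (fun n : ℕ => profile (n + 1) x) atTop
      (𝓝 (1 - 24 * 0 * x 0 - 0 ^ 2 * (x 1 ^ 2 + x 2 ^ 2 + x 3 ^ 2))) := by
    have := ((h0.const_mul 24).mul_const (x 0)).const_sub 1 |>.sub
      ((h0.pow 2).mul_const (x 1 ^ 2 + x 2 ^ 2 + x 3 ^ 2))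
    refine this.congr fun n => ?_
    unfold profile
    rw [one_div_pow]
    ring
  have h2 := ((tendsto_const_nhds (x := (0 : ℝ))).max h1).pow 2 |>.const_mul (Real.exp (-4 * x 0))
  simpa [weight] using h2

end Densities

/-- The divergence of the weighted energy flux of a wave is nonpositive. -/
lemma divergence_weighted_flux_nonpos {u : Coord 4 → ℝ} {δ : ℝ} (hu : ContDiff ℝ ∞ u)
    (hδ : |δ| ≤ 1 / 2) {R : ℝ} (hR : 0 < R) {x : Coord 4} (hbox : flatBox u x = 0)
    (hx : ∀ j, j ≠ 0 → |x j| ≤ R) :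
    pd 0 (fun y => weight R y * energyDensity δ u y) x
      + pd 1 (fun y => weight R y * (u y ^ 2 - normalFlux δ u y)) x
      + pd 2 (fun y => weight R y * (0 - tangentialFlux δ 2 u y)) x
      + pd 3 (fun y => weight R y * (0 - tangentialFlux δ 3 u y)) x ≤ 0 := by
  have hw : DifferentiableAt ℝ (weight R) x := ((contDiff_weight R).differentiable (by simp)) x
  have hd : DifferentiableAt ℝ u x := (hu.differentiable (by simp)) x
  have hp : ∀ i, DifferentiableAt ℝ (pd i u) x := fun i => ((smooth_pd hu i).differentiable (by simp)) x
  have hp0 := hp 0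
  have hp1 := hp 1
  have hp2 := hp 2
  have hp3 := hp 3
  have c10 := congrFun (pd_comm hu 1 0) x
  have c20 := congrFun (pd_comm hu 2 0) x
  have c30 := congrFun (pd_comm hu 3 0) x
  have c21 := congrFun (pd_comm hu 2 1) x
  have c31 := congrFun (pd_comm hu 3 1) x
  have hE : DifferentiableAt ℝ (energyDensity δ u) x := by unfold energyDensity; fun_prop
  have hJ1 : DifferentiableAt ℝ (fun y => u y ^ 2 - normalFlux δ u y) x := by
    unfold normalFlux; fun_prop
  have hJ2 : DifferentiableAt ℝ (fun y => 0 - tangentialFlux δ 2 u y) x := by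
    unfold tangentialFlux; fun_prop
  have hJ3 : DifferentiableAt ℝ (fun y => 0 - tangentialFlux δ 3 u y) x := by
    unfold tangentialFlux; fun_prop
  -- The energy balance. The zeroth order terms form the field `u² (∂_t + ∂_1)`: besides `u²` on
  -- slices it yields `u²` on the side with a good sign, so no trace inequality is needed.
  have bal : pd 0 (energyDensity δ u) x + pd 1 (fun y => u y ^ 2 - normalFlux δ u y) x
      + pd 2 (fun y => 0 - tangentialFlux δ 2 u y) x
      + pd 3 (fun y => 0 - tangentialFlux δ 3 u y) x
      = 2 * u x * pd 0 u x + 2 * u x * pd 1 u x := by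
    unfold energyDensity normalFlux tangentialFlux
    simp (disch := fun_prop) only [pd_sub, pd_add, pd_const_mul, pd_sq, pd_const, pd_mul]
    rw [c10, c20, c30, c21, c31]
    unfold flatBox at hbox
    linear_combination (-pd 0 u x - δ * pd 1 u x) * hbox
  have b1 := abs_normalFlux_le (u := u) hδ x
  have b2 := abs_tangentialFlux_le (u := u) hδ (Or.inl rfl) x
  have b3 := abs_tangentialFlux_le (u := u) hδ (Or.inr rfl) x
  have bE := le_energyDensity (u := u) hδ x
  have hG := gradSq_nonneg u x
  have hG' : pd 0 u x ^ 2 + pd 1 u x ^ 2 ≤ gradSq u x := by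
    unfold gradSq; nlinarith [sq_nonneg (pd 2 u x), sq_nonneg (pd 3 u x)]
  rw [pd_mul hw hE, pd_mul hw hJ1, pd_mul hw hJ2, pd_mul hw hJ3]
  have hwt := weight_nonneg R x
  -- The source `2u (∂_0 u + ∂_1 u)` is absorbed by the derivative of `exp(-4t)`, because four times
  -- the energy dominates `|∇u|² + 4u²`.
  have zero_order : weight R x * (2 * u x * pd 0 u x + 2 * u x * pd 1 u x
      - 4 * energyDensity δ u x) ≤ 0 := by
    refine mul_nonpos_of_nonneg_of_nonpos hwt ?_
    nlinarith [sq_nonneg (u x - pd 0 u x), sq_nonneg (u x - pd 1 u x)]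
  have hmul : ∀ j, j ≠ 0 → ∀ a B : ℝ, |a| ≤ B → -(x j / R) * a ≤ B := by
    intro j hj a B hab
    have h1 : |x j / R| ≤ 1 := by
      rw [abs_div, abs_of_pos hR]; exact div_le_one_of_le₀ (hx j hj) hR.le
    calc -(x j / R) * a ≤ |-(x j / R) * a| := le_abs_self _
      _ = |x j / R| * |a| := by rw [abs_mul, abs_neg]
      _ ≤ 1 * B := by gcongr
      _ = B := one_mul B
  have m1 := hmul 1 (by simp) (u x ^ 2 - normalFlux δ u x) (u x ^ 2 + gradSq u x) (by
    rw [abs_le] at b1 ⊢; constructor <;> nlinarith [sq_nonneg (u x)])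
  have m2 := hmul 2 (by simp) (0 - tangentialFlux δ 2 u x) (gradSq u x) (by
    rw [zero_sub, abs_neg]; exact b2)
  have m3 := hmul 3 (by simp) (0 - tangentialFlux δ 3 u x) (gradSq u x) (by
    rw [zero_sub, abs_neg]; exact b3)
  -- Origin of 24: the three spatial fluxes add up to at most `u² + 3 |∇u|²`, they enter with slopes
  -- at most `2 / R`, and the energy is at least `|∇u|² / 4 + u²`. Thus the time slope must be at
  -- least `4 · 2 · 3 / R`.
  have main : 0 ≤ 24 * energyDensity δ u x
      - 2 * (-(x 1 / R) * (u x ^ 2 - normalFlux δ u x)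
        + -(x 2 / R) * (0 - tangentialFlux δ 2 u x)
        + -(x 3 / R) * (0 - tangentialFlux δ 3 u x)) := by
    nlinarith [sq_nonneg (u x)]
  have hA : 0 ≤ Real.exp (-4 * x 0) * (2 * max 0 (profile R x)) / R := by positivity
  have main' := mul_nonneg hA main
  simp only [pd_weight, pd_profile_zero, pd_profile R x (show (1 : Fin 4) ≠ 0 by simp),
    pd_profile R x (show (2 : Fin 4) ≠ 0 by simp), pd_profile R x (show (3 : Fin 4) ≠ 0 by simp)]
  simp only [if_true, if_neg (show (1 : Fin 4) ≠ 0 by simp), if_neg (show (2 : Fin 4) ≠ 0 by simp),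
    if_neg (show (3 : Fin 4) ≠ 0 by simp), zero_mul, zero_add]
  have hfin := add_nonpos zero_order (neg_nonpos.2 main')
  refine le_trans (le_of_eq ?_) hfin
  linear_combination (weight R x) * bal

/-! ### Removal of the truncation -/

/-- Fatou's lemma: bounds uniform in the truncation radius pass to the limit. No integrability is
required, so `M` may be infinite. -/
lemma lintegral_le_of_tendsto {X : Type*} [MeasurableSpace X] {ν : Measure X} {g g' : X → ℝ}
    {w : ℕ → X → ℝ} {v : X → ℝ} {M : ℝ≥0∞} (hm : ∀ n, Measurable fun x => w n x * g x)
    (hlim : ∀ x, Tendsto (fun n => w n x) atTop (𝓝 (v x)))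
    (hv : ∀ᵐ x ∂ν, g' x ≤ v x * g x)
    (hM : ∀ n, ∫⁻ x, ENNReal.ofReal (w n x * g x) ∂ν ≤ M) :
    ∫⁻ x, ENNReal.ofReal (g' x) ∂ν ≤ M := by
  calc ∫⁻ x, ENNReal.ofReal (g' x) ∂ν
      ≤ ∫⁻ x, liminf (fun n => ENNReal.ofReal (w n x * g x)) atTop ∂ν := by
        refine lintegral_mono_ae ?_
        filter_upwards [hv] with x hx
        rw [(ENNReal.tendsto_ofReal ((hlim x).mul_const (g x))).liminf_eq]
        exact ENNReal.ofReal_le_ofReal hx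
    _ ≤ liminf (fun n => ∫⁻ x, ENNReal.ofReal (w n x * g x) ∂ν) atTop :=
        lintegral_liminf_le fun n => (hm n).ennreal_ofReal
    _ ≤ M := (liminf_le_liminf (Eventually.of_forall hM)).trans (by simp)

/-- For a function that vanishes outside a compact box, the integral over a region containing the
box as a lower integral. -/
lemma setLIntegral_eq_ofReal_integral {n : ℕ} {a b : Coord n} {S : Set (Coord n)}
    (hsub : Icc a b ⊆ S) {g : Coord n → ℝ} (hg : Continuous g)
    (hnn : ∀ x ∈ S, 0 ≤ g x) (hS : MeasurableSet S) (hz : ∀ x ∈ S, x ∉ Icc a b → g x = 0) :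
    ∫⁻ x in S, ENNReal.ofReal (g x) = ENNReal.ofReal (∫ x in Icc a b, g x) := by
  rw [ofReal_integral_eq_lintegral_ofReal (hg.continuousOn.integrableOn_compact isCompact_Icc)
    ((ae_restrict_iff' measurableSet_Icc).2 (Eventually.of_forall fun x hx => hnn x (hsub hx)))]
  rw [← lintegral_indicator hS, ← lintegral_indicator measurableSet_Icc]
  congr 1
  funext x
  by_cases h1 : x ∈ Icc a b
  · rw [indicator_of_mem h1, indicator_of_mem (hsub h1)]
  · rw [indicator_of_notMem h1]
    by_cases h2 : x ∈ S
    · rw [indicator_of_mem h2, hz x h2 h1, ENNReal.ofReal_zero]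
    · rw [indicator_of_notMem h2]

lemma ofReal_integral_le_setLIntegral {n : ℕ} {a b : Coord n} {S : Set (Coord n)}
    (hsub : Icc a b ⊆ S) {g f : Coord n → ℝ} (hg : Continuous g)
    (hnn : ∀ x ∈ S, 0 ≤ g x) (hle : ∀ x ∈ S, g x ≤ f x) :
    ENNReal.ofReal (∫ x in Icc a b, g x) ≤ ∫⁻ x in S, ENNReal.ofReal (f x) := by
  rw [ofReal_integral_eq_lintegral_ofReal (hg.continuousOn.integrableOn_compact isCompact_Icc)
    ((ae_restrict_iff' measurableSet_Icc).2 (Eventually.of_forall fun x hx => hnn x (hsub hx)))]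
  refine (setLIntegral_mono' measurableSet_Icc fun x hx =>
    ENNReal.ofReal_le_ofReal (hle x (hsub hx))).trans ?_
  exact lintegral_mono_set hsub

lemma measurableSet_sideUpTo (t : ℝ) : MeasurableSet (sideUpTo t) :=
  (measurableSet_le measurable_const (measurable_pi_apply 0)).inter
    (measurableSet_le (measurable_pi_apply 0) measurable_const)

lemma measurableSet_slice : MeasurableSet {z : Coord 3 | z 0 ≤ 0} :=
  measurableSet_le (measurable_pi_apply 0) measurable_const

/-- The weighted energy inequality on a truncated region. -/
lemma weighted_energy_le {u : Coord 4 → ℝ} {δ : ℝ} (hu : ContDiff ℝ ∞ u)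
    (hwave : ∀ x ∈ corner, flatBox u x = 0) (hδ : |δ| ≤ 1 / 2) {R t : ℝ} (hR : 0 < R)
    (ht : 0 ≤ t) :
    (∫ z in Icc ![-R, -R, -R] ![0, R, R],
        weight R (slicePt t z) * energyDensity δ u (slicePt t z))
      + (∫ y in Icc ![0, -R, -R] ![t, R, R],
        weight R (sidePt y) * (u (sidePt y) ^ 2 - normalFlux δ u (sidePt y)))
      ≤ ∫ z in Icc ![-R, -R, -R] ![0, R, R],
        weight R (slicePt 0 z) * energyDensity δ u (slicePt 0 z) := by
  have hw := contDiff_weight R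
  have h0 : ContDiff ℝ 1 u := hu.of_le (by simp)
  have h1 : ∀ i, ContDiff ℝ 1 (pd i u) := fun i => (smooth_pd hu i).of_le (by simp)
  have q0 := h1 0
  have q1 := h1 1
  have q2 := h1 2
  have q3 := h1 3
  refine boundary_flux_nonpos ht hR
    ![fun y => weight R y * energyDensity δ u y,
      fun y => weight R y * (u y ^ 2 - normalFlux δ u y),
      fun y => weight R y * (0 - tangentialFlux δ 2 u y),
      fun y => weight R y * (0 - tangentialFlux δ 3 u y)] ?_ ?_ ?_
  · intro i
    fin_cases i
    · exact hw.mul (by unfold energyDensity; fun_prop)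
    · exact hw.mul (by unfold normalFlux; fun_prop)
    · exact hw.mul (by unfold tangentialFlux; fun_prop)
    · exact hw.mul (by unfold tangentialFlux; fun_prop)
  · rintro i x hx ⟨j, hj, hxj⟩
    have := weight_eq_zero hR hx hj hxj.ge
    fin_cases i <;> simp [this]
  · intro x hx hxR
    exact divergence_weighted_flux_nonpos hu hδ hR (hwave x hx) hxR

lemma mem_box_of_abs {a b x : Coord 3} {R : ℝ} (j : Fin 3) (hj : a j ≤ x j ∧ x j ≤ b j)
    (ha : ∀ i, i ≠ j → a i = -R ∧ b i = R) (hx : ∀ i, i ≠ j → |x i| < R) : x ∈ Icc a b := by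
  constructor <;> intro i <;> by_cases h : i = j
  · subst h; exact hj.1
  · rw [(ha i h).1]; exact (abs_lt.1 (hx i h)).1.le
  · subst h; exact hj.2
  · rw [(ha i h).2]; exact (abs_lt.1 (hx i h)).2.le

/-- The energy inequality for a wave whose flux through the side is controlled. -/
lemma energy_bound {u : Coord 4 → ℝ} {δ c t T : ℝ} {K : Coord 4 → ℝ} (hu : ContDiff ℝ ∞ u)
    (hwave : ∀ x ∈ corner, flatBox u x = 0) (hδ : |δ| ≤ 1 / 2) (hc : 0 < c) (hc1 : c ≤ 1)
    (hK : Continuous K) (hK0 : ∀ x, 0 ≤ K x)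
    (hflux : ∀ x, normalFlux δ u x ≤ -c * gradSq u x + K x)
    (ht : 0 ≤ t) (htT : t ≤ T) :
    (∫⁻ z in {z : Coord 3 | z 0 ≤ 0}, ENNReal.ofReal
        (Real.exp (-4 * T) / 4 * (gradSq u (slicePt t z) + u (slicePt t z) ^ 2))
      ≤ (∫⁻ z in {z : Coord 3 | z 0 ≤ 0}, ENNReal.ofReal
          (gradSq u (slicePt 0 z) + u (slicePt 0 z) ^ 2))
        + ∫⁻ y in sideUpTo t, ENNReal.ofReal (K (sidePt y))) ∧
    (∫⁻ y in sideUpTo t, ENNReal.ofReal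
        (Real.exp (-4 * T) * c * (gradSq u (sidePt y) + u (sidePt y) ^ 2))
      ≤ (∫⁻ z in {z : Coord 3 | z 0 ≤ 0}, ENNReal.ofReal
          (gradSq u (slicePt 0 z) + u (slicePt 0 z) ^ 2))
        + ∫⁻ y in sideUpTo t, ENNReal.ofReal (K (sidePt y))) := by
  set M := (∫⁻ z in {z : Coord 3 | z 0 ≤ 0}, ENNReal.ofReal
          (gradSq u (slicePt 0 z) + u (slicePt 0 z) ^ 2))
        + ∫⁻ y in sideUpTo t, ENNReal.ofReal (K (sidePt y)) with hM
  have cu : Continuous u := hu.continuous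
  have cp : ∀ i, Continuous (pd i u) := fun i => (smooth_pd hu i).continuous
  have cp0 := cp 0
  have cp1 := cp 1
  have cp2 := cp 2
  have cp3 := cp 3
  have cE : Continuous (energyDensity δ u) := by unfold energyDensity; fun_prop
  have cG : Continuous (gradSq u) := by unfold gradSq; fun_prop
  have cJ : Continuous (normalFlux δ u) := by unfold normalFlux; fun_prop
  have cW : ∀ R, Continuous (weight R) := fun R => (contDiff_weight R).continuous
  have cS := continuous_slicePt
  have cB := continuous_sidePt
  have hE0 : ∀ x, 0 ≤ energyDensity δ u x := fun x => by
    have := le_energyDensity (u := u) hδ x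
    nlinarith [gradSq_nonneg u x, sq_nonneg (u x)]
  have hGu : ∀ x, 0 ≤ gradSq u x + u x ^ 2 := fun x => by
    nlinarith [gradSq_nonneg u x, sq_nonneg (u x)]
  have sub1 : ∀ R : ℝ, Icc (![-R, -R, -R] : Coord 3) ![0, R, R] ⊆ {z : Coord 3 | z 0 ≤ 0} :=
    fun R z hz => hz.2 0
  have sub2 : ∀ R : ℝ, Icc (![0, -R, -R] : Coord 3) ![t, R, R] ⊆ sideUpTo t :=
    fun R y hy => ⟨hy.1 0, hy.2 0⟩
  have trunc : ∀ R : ℝ, 0 < R →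
      ENNReal.ofReal (∫ z in Icc ![-R, -R, -R] ![0, R, R],
        weight R (slicePt t z) * energyDensity δ u (slicePt t z)) ≤ M ∧
      ENNReal.ofReal (∫ y in Icc ![0, -R, -R] ![t, R, R],
        weight R (sidePt y) * (c * (gradSq u (sidePt y) + u (sidePt y) ^ 2))) ≤ M := by
    intro R hR
    have key := weighted_energy_le hu hwave hδ hR ht
    have hsplit : (∫ y in Icc ![0, -R, -R] ![t, R, R],
          weight R (sidePt y) * (c * (gradSq u (sidePt y) + u (sidePt y) ^ 2)))
        - (∫ y in Icc ![0, -R, -R] ![t, R, R], weight R (sidePt y) * K (sidePt y))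
        ≤ ∫ y in Icc ![0, -R, -R] ![t, R, R],
          weight R (sidePt y) * (u (sidePt y) ^ 2 - normalFlux δ u (sidePt y)) := by
      have int : ∀ g : Coord 3 → ℝ, Continuous g →
          IntegrableOn g (Icc ![0, -R, -R] ![t, R, R]) := fun g hg =>
        hg.continuousOn.integrableOn_compact isCompact_Icc
      have cWB : Continuous fun y => weight R (sidePt y) := (cW R).comp cB
      rw [← integral_sub (int _ (by fun_prop)) (int _ (by fun_prop))]
      refine setIntegral_mono_on ((int _ (by fun_prop)).sub (int _ (by fun_prop)))
        (int _ (by fun_prop)) measurableSet_Icc fun y _ => ?_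
      rw [← mul_sub]
      refine mul_le_mul_of_nonneg_left ?_ (weight_nonneg R _)
      -- The flux bound supplies `c |∇u|² - K`; the remaining `u²` dominates `c u²` because `c ≤ 1`.
      nlinarith [hflux (sidePt y), mul_nonneg (sub_nonneg.2 hc1) (sq_nonneg (u (sidePt y)))]
    have p1 : 0 ≤ ∫ z in Icc ![-R, -R, -R] ![0, R, R],
        weight R (slicePt t z) * energyDensity δ u (slicePt t z) :=
      setIntegral_nonneg measurableSet_Icc fun z _ => mul_nonneg (weight_nonneg R _) (hE0 _)
    have p2 : 0 ≤ ∫ y in Icc ![0, -R, -R] ![t, R, R],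
        weight R (sidePt y) * (c * (gradSq u (sidePt y) + u (sidePt y) ^ 2)) :=
      setIntegral_nonneg measurableSet_Icc fun y _ =>
        mul_nonneg (weight_nonneg R _) (mul_nonneg hc.le (hGu _))
    have b1 : ENNReal.ofReal (∫ z in Icc ![-R, -R, -R] ![0, R, R],
        weight R (slicePt 0 z) * energyDensity δ u (slicePt 0 z)) ≤
        ∫⁻ z in {z : Coord 3 | z 0 ≤ 0}, ENNReal.ofReal
          (gradSq u (slicePt 0 z) + u (slicePt 0 z) ^ 2) := by
      refine ofReal_integral_le_setLIntegral (sub1 R)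
        (((cW R).comp (cS 0)).mul (cE.comp (cS 0)))
        (fun z _ => mul_nonneg (weight_nonneg R _) (hE0 _)) fun z _ => ?_
      exact (mul_le_of_le_one_left (hE0 _) (weight_le_one hR (by simp [slicePt]))).trans
        (energyDensity_le hδ _)
    have b2 : ENNReal.ofReal (∫ y in Icc ![0, -R, -R] ![t, R, R],
        weight R (sidePt y) * K (sidePt y)) ≤
        ∫⁻ y in sideUpTo t, ENNReal.ofReal (K (sidePt y)) := by
      refine ofReal_integral_le_setLIntegral (sub2 R) (((cW R).comp cB).mul (hK.comp cB))
        (fun y _ => mul_nonneg (weight_nonneg R _) (hK0 _)) fun y hy => ?_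
      exact mul_le_of_le_one_left (hK0 _) (weight_le_one hR (by simpa [sidePt] using hy.1))
    have hsum := (ENNReal.ofReal_add_le (p := ∫ z in Icc ![-R, -R, -R] ![0, R, R],
        weight R (slicePt 0 z) * energyDensity δ u (slicePt 0 z))
        (q := ∫ y in Icc ![0, -R, -R] ![t, R, R],
        weight R (sidePt y) * K (sidePt y))).trans (add_le_add b1 b2)
    -- Slice and side terms are both nonnegative, so the bound on their sum bounds each of them.
    exact ⟨(ENNReal.ofReal_le_ofReal (by linarith)).trans hsum,
      (ENNReal.ofReal_le_ofReal (by linarith)).trans hsum⟩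
  have hpos : ∀ n : ℕ, (0 : ℝ) < n + 1 := fun n => by positivity
  constructor
  · refine lintegral_le_of_tendsto (w := fun n z => weight (n + 1) (slicePt t z))
      (g := fun z => energyDensity δ u (slicePt t z))
      (fun n => (((cW _).comp (cS t)).mul (cE.comp (cS t))).measurable)
      (fun z => tendsto_weight _) (Eventually.of_forall fun z => ?_) fun n => ?_
    · have h1 := le_energyDensity (u := u) hδ (slicePt t z)
      -- On `[0, T]` the limiting weight is at least `exp(-4T)`; this is the only source of the
      -- dependence on `T`.
      have h2 : Real.exp (-4 * T) ≤ Real.exp (-4 * slicePt t z 0) :=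
        Real.exp_le_exp.2 (by simp only [slicePt, Matrix.cons_val_zero]; linarith)
      have h3 : 1 / 4 * (gradSq u (slicePt t z) + u (slicePt t z) ^ 2)
          ≤ energyDensity δ u (slicePt t z) := by nlinarith [sq_nonneg (u (slicePt t z))]
      calc _ = Real.exp (-4 * T) * (1 / 4 * (gradSq u (slicePt t z) + u (slicePt t z) ^ 2)) := by
            ring
        _ ≤ _ := mul_le_mul h2 h3 (mul_nonneg (by norm_num) (hGu _)) (Real.exp_pos _).le
    · refine le_trans (le_of_eq ?_) (trunc (n + 1) (hpos n)).1
      refine setLIntegral_eq_ofReal_integral (sub1 _)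
        (((cW _).comp (cS t)).mul (cE.comp (cS t)))
        (fun z _ => mul_nonneg (weight_nonneg _ _) (hE0 _)) measurableSet_slice fun z hz hz' => ?_
      -- A point of the half space outside the box has a spatial coordinate of size at least `n +
      -- 1`, and there the weight is zero.
      have hex : ∃ j : Fin 4, j ≠ 0 ∧ (n : ℝ) + 1 ≤ |slicePt t z j| := by
        by_contra! hcon
        have g1 : |z 0| < (n : ℝ) + 1 := hcon 1 (by simp)
        have g2 : |z 1| < (n : ℝ) + 1 := hcon 2 (by simp)
        have g3 : |z 2| < (n : ℝ) + 1 := hcon 3 (by simp)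
        refine hz' (mem_box_of_abs (R := n + 1) 0 ⟨(abs_lt.1 g1).1.le, hz⟩ ?_ ?_)
        · intro i hi; fin_cases i
          · exact absurd rfl hi
          all_goals exact ⟨rfl, rfl⟩
        · intro i hi; fin_cases i
          · exact absurd rfl hi
          · exact g2
          · exact g3
      obtain ⟨j, hj, hjR⟩ := hex
      rw [weight_eq_zero (hpos n) (by simpa [slicePt] using ht) hj hjR, zero_mul]
  · refine lintegral_le_of_tendsto (w := fun n y => weight (n + 1) (sidePt y))
      (g := fun y => c * (gradSq u (sidePt y) + u (sidePt y) ^ 2))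
      (fun n => (((cW _).comp cB).mul (by fun_prop)).measurable)
      (fun y => tendsto_weight _)
      ((ae_restrict_iff' (measurableSet_sideUpTo t)).2 (Eventually.of_forall fun y hy => ?_))
      fun n => ?_
    · have h2 : Real.exp (-4 * T) ≤ Real.exp (-4 * sidePt y 0) :=
        Real.exp_le_exp.2 (by have := hy.2; simp only [sidePt, Matrix.cons_val_zero]; linarith)
      rw [mul_assoc]
      exact mul_le_mul_of_nonneg_right h2 (mul_nonneg hc.le (hGu _))
    · refine le_trans (le_of_eq ?_) (trunc (n + 1) (hpos n)).2
      refine setLIntegral_eq_ofReal_integral (sub2 _)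
        (((cW _).comp cB).mul (by fun_prop))
        (fun y _ => mul_nonneg (weight_nonneg _ _) (mul_nonneg hc.le (hGu _)))
        (measurableSet_sideUpTo t) fun y hy hy' => ?_
      have hex : ∃ j : Fin 4, j ≠ 0 ∧ (n : ℝ) + 1 ≤ |sidePt y j| := by
        by_contra! hcon
        have g2 : |y 1| < (n : ℝ) + 1 := hcon 2 (by simp)
        have g3 : |y 2| < (n : ℝ) + 1 := hcon 3 (by simp)
        refine hy' (mem_box_of_abs (R := n + 1) 0 hy ?_ ?_)
        · intro i hi; fin_cases i
          · exact absurd rfl hi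
          all_goals exact ⟨rfl, rfl⟩
        · intro i hi; fin_cases i
          · exact absurd rfl hi
          · exact g2
          · exact g3
      obtain ⟨j, hj, hjR⟩ := hex
      rw [weight_eq_zero (hpos n) (by simpa [sidePt] using hy.1) hj hjR, zero_mul]

/-! ### Families of smooth functions -/

/-- Families of smooth functions on `ℝ⁴`. Estimates for families are uniform in the index. -/
def SmoothFam (ι : Type*) : Submodule ℝ (ι → Coord 4 → ℝ) where
  carrier := {u | ∀ e, ContDiff ℝ ∞ (u e)}
  zero_mem' _ := contDiff_const
  add_mem' hu hv e := (hu e).add (hv e)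
  smul_mem' _ _ hu e := contDiff_const.mul (hu e)

variable {ι : Type*}

lemma smoothFam_smooth (u : SmoothFam ι) (e : ι) : ContDiff ℝ ∞ (u.1 e) := u.2 e

lemma smoothFam_differentiable (u : SmoothFam ι) (e : ι) : Differentiable ℝ (u.1 e) :=
  (u.2 e).differentiable (by simp)

/-- The partial derivative `∂_i` of a family of smooth functions. -/
def D (i : Fin 4) : SmoothFam ι →ₗ[ℝ] SmoothFam ι where
  toFun u := ⟨fun e => pd i (u.1 e), fun e => smooth_pd (u.2 e) i⟩
  map_add' u v := by
    ext e x
    exact pd_add (smoothFam_differentiable u e x) (smoothFam_differentiable v e x)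
  map_smul' c u := by
    ext e x
    exact pd_const_mul c (smoothFam_differentiable u e x)

lemma D_apply (i : Fin 4) (u : SmoothFam ι) (e : ι) : (D i u).1 e = pd i (u.1 e) := rfl

lemma D_comm (i j : Fin 4) (u : SmoothFam ι) : D i (D j u) = D j (D i u) := by
  ext e x
  exact congrFun (pd_comm (u.2 e) i j) x

/-- The families all of whose derivatives of order at most `k` in the directions from `I` lie
in `S`. -/
def jets (I : Set (Fin 4)) (S : Submodule ℝ (SmoothFam ι)) :
    ℕ → Submodule ℝ (SmoothFam ι)
  | 0 => S
  | k + 1 => S ⊓ ⨅ i ∈ I, (jets I S k).comap (D i)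

section Jets

variable {I J : Set (Fin 4)} {S S' K : Submodule ℝ (SmoothFam ι)} {k l : ℕ} {u : SmoothFam ι}

lemma mem_jets_succ : u ∈ jets I S (k + 1) ↔ u ∈ S ∧ ∀ i ∈ I, D i u ∈ jets I S k := by
  simp [jets]

lemma jets_le_base (I : Set (Fin 4)) (S : Submodule ℝ (SmoothFam ι)) (k : ℕ) :
    jets I S k ≤ S := by
  cases k with
  | zero => exact le_rfl
  | succ k => exact inf_le_left

lemma D_mem_jets (hu : u ∈ jets I S (k + 1)) {i : Fin 4} (hi : i ∈ I) : D i u ∈ jets I S k :=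
  (mem_jets_succ.1 hu).2 i hi

lemma jets_mono (hI : I ⊆ J) (hS : S ≤ S') : jets J S k ≤ jets I S' k := by
  induction k with
  | zero => exact hS
  | succ k ih =>
    intro u hu
    rw [mem_jets_succ] at hu ⊢
    exact ⟨hS hu.1, fun i hi => ih (hu.2 i (hI hi))⟩

lemma jets_succ_le : jets I S (k + 1) ≤ jets I S k := by
  induction k with
  | zero => exact jets_le_base I S 1
  | succ k ih =>
    intro u hu
    rw [mem_jets_succ] at hu ⊢
    exact ⟨hu.1, fun i hi => ih (hu.2 i hi)⟩

lemma jets_antitone (h : k ≤ l) : jets I S l ≤ jets I S k :=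
  antitone_nat_of_succ_le (fun _ => jets_succ_le) h

/-- A subspace stable under the derivatives from `I` needs a bound at order zero only. This is
applied to the two spaces of vanishing families. -/
lemma invariant_le_jets (hS : K ≤ S) (hD : ∀ i ∈ I, ∀ u ∈ K, D i u ∈ K) (k : ℕ) :
    K ≤ jets I S k := by
  induction k with
  | zero => exact hS
  | succ k ih => exact fun u hu => mem_jets_succ.2 ⟨hS hu, fun i hi => ih (hD i hi u hu)⟩

end Jets

/-! ### Families vanishing on a set, and waves -/

/-- The families of functions that vanish on `A`. -/
def vanishing (ι : Type*) (A : Set (Coord 4)) : Submodule ℝ (SmoothFam ι) where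
  carrier := {u | ∀ e, ∀ x ∈ A, u.1 e x = 0}
  zero_mem' _ _ _ := rfl
  add_mem' {u v} hu hv e x hx := by
    change u.1 e x + v.1 e x = 0
    rw [hu e x hx, hv e x hx, add_zero]
  smul_mem' c u hu e x hx := by
    change c * u.1 e x = 0
    rw [hu e x hx, mul_zero]

lemma corner_subset_closure : corner ⊆ closure {x : Coord 4 | 0 < x 0 ∧ x 1 < 0} := by
  intro x hx
  refine mem_closure_of_tendsto (b := atTop)
    (f := fun n : ℕ => fun i => x i + (1 / ((n : ℝ) + 1)) * (![1, -1, 0, 0] : Coord 4) i) ?_ ?_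
  · refine tendsto_pi_nhds.2 fun i => ?_
    simpa using (tendsto_one_div_add_atTop_nhds_zero_nat (𝕜 := ℝ)).mul_const
      ((![1, -1, 0, 0] : Coord 4) i) |>.const_add (x i)
  · refine Eventually.of_forall fun n => ?_
    have hn : 0 < 1 / ((n : ℝ) + 1) := by positivity
    obtain ⟨h0, h1⟩ := hx
    constructor
    · simp only [Matrix.cons_val_zero]; linarith
    · simp only [Matrix.cons_val_one, Matrix.cons_val_zero]; linarith

/-- At interior points the family vanishes in a neighbourhood. Continuity extends the vanishing of
derivatives to the boundary, because the corner lies in the closure of its interior. -/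
lemma D_mem_vanishing_corner {u : SmoothFam ι} (hu : u ∈ vanishing ι corner) (i : Fin 4) :
    D i u ∈ vanishing ι corner := by
  intro e
  have hcl : IsClosed {x | pd i (u.1 e) x = 0} :=
    isClosed_eq (smooth_pd (u.2 e) i).continuous continuous_const
  refine fun x hx => closure_minimal ?_ hcl (corner_subset_closure hx)
  intro x hx
  have hopen : IsOpen {x : Coord 4 | 0 < x 0 ∧ x 1 < 0} :=
    (isOpen_lt continuous_const (continuous_apply 0)).inter
      (isOpen_lt (continuous_apply 1) continuous_const)
  have hev : u.1 e =ᶠ[𝓝 x] fun _ => 0 := by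
    filter_upwards [hopen.mem_nhds hx] with z hz
    exact hu e z ⟨hz.1.le, hz.2.le⟩
  change pd i (u.1 e) x = 0
  rw [pd_congr_of_eventuallyEq hev, pd_const]

/-- The side at positive times. -/
def openSide : Set (Coord 4) := {x | 0 < x 0 ∧ x 1 = 0}

lemma exists_sidePt {x : Coord 4} (hx : x 1 = 0) : ∃ y, sidePt y = x ∧ y 0 = x 0 :=
  ⟨![x 0, x 2, x 3], by funext i; fin_cases i <;> simp [sidePt, hx], rfl⟩

lemma exists_sideIdx {i : Fin 4} (hi : i ≠ 1) : ∃ j, sideIdx j = i := by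
  fin_cases i
  · exact ⟨0, rfl⟩
  · exact absurd rfl hi
  · exact ⟨1, rfl⟩
  · exact ⟨2, rfl⟩

/-- Positivity of time makes the set open within the hyperplane `x¹ = 0`, so that `∂_0` acts inside
it like the other tangential derivatives. -/
lemma D_mem_vanishing_openSide {u : SmoothFam ι} (hu : u ∈ vanishing ι openSide) {i : Fin 4}
    (hi : i ≠ 1) : D i u ∈ vanishing ι openSide := by
  rintro e x ⟨h0, h1⟩
  obtain ⟨y, rfl, hy⟩ := exists_sidePt h1
  obtain ⟨j, rfl⟩ := exists_sideIdx hi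
  rw [D_apply, ← pd_comp_sidePt (smoothFam_differentiable u e)]
  have hev : (fun y => u.1 e (sidePt y)) =ᶠ[𝓝 y] fun _ => 0 := by
    have hopen : IsOpen {y : Coord 3 | 0 < y 0} := isOpen_lt continuous_const (continuous_apply 0)
    filter_upwards [hopen.mem_nhds (show 0 < y 0 from h0)] with z hz
    exact hu e _ ⟨hz, rfl⟩
  rw [pd_congr_of_eventuallyEq hev, pd_const]

/-- The wave operator on families. -/
def boxFam : SmoothFam ι →ₗ[ℝ] SmoothFam ι :=
  -(D 0 ∘ₗ D 0) + D 1 ∘ₗ D 1 + D 2 ∘ₗ D 2 + D 3 ∘ₗ D 3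

lemma boxFam_eq (u : SmoothFam ι) :
    boxFam u = -(D 0 (D 0 u)) + D 1 (D 1 u) + D 2 (D 2 u) + D 3 (D 3 u) := rfl

/-- The families of solutions of the wave equation in the corner domain. -/
def waves (ι : Type*) : Submodule ℝ (SmoothFam ι) :=
  (vanishing ι corner).comap boxFam

lemma mem_waves {u : SmoothFam ι} :
    u ∈ waves ι ↔ ∀ e, ∀ x ∈ corner, flatBox (u.1 e) x = 0 := Iff.rfl

lemma D_mem_waves {u : SmoothFam ι} (hu : u ∈ waves ι) (i : Fin 4) : D i u ∈ waves ι := by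
  have h := D_mem_vanishing_corner hu i
  rw [boxFam_eq] at h
  change boxFam (D i u) ∈ vanishing ι corner
  rw [boxFam_eq]
  simp only [map_add, map_neg] at h
  have comm : ∀ j, D j (D j (D i u)) = D i (D j (D j u)) := fun j => by
    rw [D_comm j i u, D_comm j i]
  rwa [comm, comm, comm, comm]

/-! ### Families bounded by the data -/

/-- The measure of the slice `S_t`. -/
def sliceMeasure (t : ℝ) : Measure (Coord 4) :=
  (volume.restrict {z : Coord 3 | z 0 ≤ 0}).map (slicePt t)

/-- The measure of the side up to time `t`. -/
def sideMeasure (t : ℝ) : Measure (Coord 4) :=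
  (volume.restrict (sideUpTo t)).map sidePt

lemma lintegral_sliceMeasure {f : Coord 4 → ℝ≥0∞} (hf : Measurable f) (t : ℝ) :
    ∫⁻ x, f x ∂sliceMeasure t = ∫⁻ z in {z : Coord 3 | z 0 ≤ 0}, f (slicePt t z) :=
  lintegral_map hf (continuous_slicePt t).measurable

lemma lintegral_sideMeasure {f : Coord 4 → ℝ≥0∞} (hf : Measurable f) (t : ℝ) :
    ∫⁻ x, f x ∂sideMeasure t = ∫⁻ y in sideUpTo t, f (sidePt y) :=
  lintegral_map hf continuous_sidePt.measurable

lemma ae_sliceMeasure {t : ℝ} (ht : 0 ≤ t) : ∀ᵐ x ∂sliceMeasure t, x ∈ corner := by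
  have hc : MeasurableSet corner :=
    (measurableSet_le measurable_const (measurable_pi_apply 0)).inter
      (measurableSet_le (measurable_pi_apply 1) measurable_const)
  refine (ae_map_iff (p := (· ∈ corner)) (continuous_slicePt t).aemeasurable hc).2 ?_
  rw [ae_restrict_iff' measurableSet_slice]
  exact Eventually.of_forall fun z hz => ⟨ht, hz⟩

/-- The edge `t = 0` is discarded because boundary data are prescribed for `t ≥ 0` only and are
arbitrary before; their partial derivatives at the edge carry no information. -/
lemma ae_side_pos (t : ℝ) : ∀ᵐ y ∂volume.restrict (sideUpTo t), 0 < y 0 := by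
  have hne : ∀ᵐ y : Coord 3, y 0 ≠ 0 := Measure.ae_eval_ne (fun _ => volume) 0 0
  rw [ae_restrict_iff' (measurableSet_sideUpTo t)]
  filter_upwards [hne] with y hy hyt
  exact lt_of_le_of_ne hyt.1 hy.symm

lemma ae_sideMeasure (t : ℝ) : ∀ᵐ x ∂sideMeasure t, x ∈ openSide := by
  have hc : MeasurableSet openSide :=
    (measurableSet_lt measurable_const (measurable_pi_apply 0)).inter
      (measurableSet_eq_fun (measurable_pi_apply 1) measurable_const)
  refine (ae_map_iff (p := (· ∈ openSide)) continuous_sidePt.aemeasurable hc).2 ?_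
  filter_upwards [ae_side_pos t] with y hy
  exact ⟨hy, rfl⟩

/-- The families of functions whose squared `L²` norms with respect to the measures `μ t` are
bounded by a constant times `N e t`. -/
def l2Bounded (μ : ℝ → Measure (Coord 4)) (N : ι → ℝ → ℝ≥0∞) (T : ℝ) :
    Submodule ℝ (SmoothFam ι) where
  carrier := {u | ∃ C : ℝ≥0, ∀ e t, 0 ≤ t → t ≤ T →
    ∫⁻ x, ENNReal.ofReal (u.1 e x ^ 2) ∂μ t ≤ C * N e t}
  zero_mem' := ⟨0, fun e t _ _ => by simp⟩
  add_mem' := by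
    rintro u v ⟨C, hC⟩ ⟨C', hC'⟩
    refine ⟨2 * C + 2 * C', fun e t h0 hT => ?_⟩
    have hu : Measurable fun x => ENNReal.ofReal (u.1 e x ^ 2) :=
      ((smoothFam_smooth u e).continuous.pow 2).measurable.ennreal_ofReal
    have hv : Measurable fun x => ENNReal.ofReal (v.1 e x ^ 2) :=
      ((smoothFam_smooth v e).continuous.pow 2).measurable.ennreal_ofReal
    calc ∫⁻ x, ENNReal.ofReal ((u.1 e x + v.1 e x) ^ 2) ∂μ t
        ≤ ∫⁻ x, (2 * ENNReal.ofReal (u.1 e x ^ 2) + 2 * ENNReal.ofReal (v.1 e x ^ 2)) ∂μ t := by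
          refine lintegral_mono fun x => ?_
          have h2 : (2 : ℝ≥0∞) = ENNReal.ofReal 2 := by simp
          rw [h2, ← ENNReal.ofReal_mul (by norm_num), ← ENNReal.ofReal_mul (by norm_num),
            ← ENNReal.ofReal_add (by positivity) (by positivity)]
          exact ENNReal.ofReal_le_ofReal (by nlinarith [sq_nonneg (u.1 e x - v.1 e x)])
      _ = 2 * ∫⁻ x, ENNReal.ofReal (u.1 e x ^ 2) ∂μ t
          + 2 * ∫⁻ x, ENNReal.ofReal (v.1 e x ^ 2) ∂μ t := by
          rw [lintegral_add_left (hu.const_mul 2), lintegral_const_mul _ hu,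
            lintegral_const_mul _ hv]
      _ ≤ 2 * (C * N e t) + 2 * (C' * N e t) := by
          gcongr
          · exact hC e t h0 hT
          · exact hC' e t h0 hT
      _ = _ := by push_cast; ring
  smul_mem' := by
    rintro c u ⟨C, hC⟩
    refine ⟨Real.toNNReal (c ^ 2) * C, fun e t h0 hT => ?_⟩
    have hu : Measurable fun x => ENNReal.ofReal (u.1 e x ^ 2) :=
      ((smoothFam_smooth u e).continuous.pow 2).measurable.ennreal_ofReal
    calc ∫⁻ x, ENNReal.ofReal ((c * u.1 e x) ^ 2) ∂μ t
        = ∫⁻ x, ENNReal.ofReal (c ^ 2) * ENNReal.ofReal (u.1 e x ^ 2) ∂μ t := by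
          refine lintegral_congr fun x => ?_
          rw [← ENNReal.ofReal_mul (by positivity), mul_pow]
      _ = ENNReal.ofReal (c ^ 2) * ∫⁻ x, ENNReal.ofReal (u.1 e x ^ 2) ∂μ t :=
          lintegral_const_mul _ hu
      _ ≤ ENNReal.ofReal (c ^ 2) * (C * N e t) := by gcongr; exact hC e t h0 hT
      _ = _ := by push_cast; rw [mul_assoc]; rfl

section Bounded

variable (N : ι → ℝ → ℝ≥0∞) (T : ℝ)

/-- The families whose derivatives of order at most `k` are bounded by the data on the slices and
on the side. -/
def controlled (k : ℕ) : Submodule ℝ (SmoothFam ι) :=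
  jets univ (l2Bounded sliceMeasure N T ⊓ l2Bounded sideMeasure N T) k

/-- The families whose tangential derivatives of order at most `k` are bounded by the data on the
side. -/
def sideControlled (k : ℕ) : Submodule ℝ (SmoothFam ι) :=
  jets {i | i ≠ 1} (l2Bounded sideMeasure N T) k

/-- The families whose derivatives of order at most `k` are bounded by the data on the initial
slice. -/
def initControlled (k : ℕ) : Submodule ℝ (SmoothFam ι) :=
  jets univ (l2Bounded (fun _ => sliceMeasure 0) N T) k

end Bounded

variable {N : ι → ℝ → ℝ≥0∞} {T : ℝ} {u : SmoothFam ι} {k : ℕ}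

lemma controlled_le_sideControlled : controlled N T k ≤ sideControlled N T k :=
  jets_mono (subset_univ _) inf_le_right

/-- The wave equation holds in the corner only, so `boxFam u` need not be the zero family. This
lemma lets it be treated as zero at every order, with constant 0. -/
lemma vanishing_corner_le_controlled : vanishing ι corner ≤ controlled N T k := by
  refine invariant_le_jets ?_ (fun i _ u hu => D_mem_vanishing_corner hu i) k
  intro u hu
  refine ⟨⟨0, fun e t h0 _ => ?_⟩, ⟨0, fun e t _ _ => ?_⟩⟩
  · rw [lintegral_congr_ae (g := fun _ => 0)]
    · simp
    · filter_upwards [ae_sliceMeasure h0] with x hx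
      simp [hu e x hx]
  · rw [lintegral_congr_ae (g := fun _ => 0)]
    · simp
    · filter_upwards [ae_sideMeasure t] with x hx
      simp [hu e x ⟨hx.1.le, hx.2.le⟩]

lemma vanishing_openSide_le_sideControlled : vanishing ι openSide ≤ sideControlled N T k := by
  refine invariant_le_jets ?_ (fun i hi u hu => D_mem_vanishing_openSide hu hi) k
  intro u hu
  refine ⟨0, fun e t _ _ => ?_⟩
  rw [lintegral_congr_ae (g := fun _ => 0)]
  · simp
  · filter_upwards [ae_sideMeasure t] with x hx
    simp [hu e x hx]

/-! ### Estimates for scalar waves -/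

lemma measurable_ofReal_sq (u : SmoothFam ι) (e : ι) :
    Measurable fun x => ENNReal.ofReal (u.1 e x ^ 2) :=
  ((smoothFam_smooth u e).continuous.pow 2).measurable.ennreal_ofReal

lemma lintegral_gradSq_add_sq (u : SmoothFam ι) (e : ι) (μ : Measure (Coord 4)) :
    ∫⁻ x, ENNReal.ofReal (gradSq (u.1 e) x + u.1 e x ^ 2) ∂μ
      = (∫⁻ x, ENNReal.ofReal ((D 0 u).1 e x ^ 2) ∂μ + ∫⁻ x, ENNReal.ofReal ((D 1 u).1 e x ^ 2) ∂μ
        + ∫⁻ x, ENNReal.ofReal ((D 2 u).1 e x ^ 2) ∂μ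
        + ∫⁻ x, ENNReal.ofReal ((D 3 u).1 e x ^ 2) ∂μ)
        + ∫⁻ x, ENNReal.ofReal (u.1 e x ^ 2) ∂μ := by
  have m := fun i => measurable_ofReal_sq (D i u) e
  rw [← lintegral_add_right _ (m 1), ← lintegral_add_right _ (m 2),
    ← lintegral_add_right _ (m 3), ← lintegral_add_right _ (measurable_ofReal_sq u e)]
  refine lintegral_congr fun x => ?_
  simp only [gradSq, D_apply]
  rw [ENNReal.ofReal_add (by positivity) (by positivity),
    ENNReal.ofReal_add (by positivity) (by positivity),
    ENNReal.ofReal_add (by positivity) (by positivity),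
    ENNReal.ofReal_add (by positivity) (by positivity)]

lemma mem_jets_one {I : Set (Fin 4)} {S : Submodule ℝ (SmoothFam ι)} :
    u ∈ jets I S 1 ↔ u ∈ S ∧ ∀ i ∈ I, D i u ∈ S := mem_jets_succ

lemma exists_bound_gradSq_init (hu : u ∈ initControlled N T 1) :
    ∃ C : ℝ≥0, ∀ e t, 0 ≤ t → t ≤ T →
      ∫⁻ x, ENNReal.ofReal (gradSq (u.1 e) x + u.1 e x ^ 2) ∂sliceMeasure 0 ≤ C * N e t := by
  obtain ⟨⟨C, hC⟩, hD⟩ := mem_jets_one.1 hu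
  obtain ⟨C0, h0⟩ := hD 0 (mem_univ _)
  obtain ⟨C1, h1⟩ := hD 1 (mem_univ _)
  obtain ⟨C2, h2⟩ := hD 2 (mem_univ _)
  obtain ⟨C3, h3⟩ := hD 3 (mem_univ _)
  refine ⟨C0 + C1 + C2 + C3 + C, fun e t ht hT => ?_⟩
  rw [lintegral_gradSq_add_sq]
  push_cast
  simp only [add_mul]
  gcongr
  exacts [h0 e t ht hT, h1 e t ht hT, h2 e t ht hT, h3 e t ht hT, hC e t ht hT]

lemma mem_l2Bounded_of_gradSq {μ : ℝ → Measure (Coord 4)} {κ : ℝ} (hκ : 0 < κ)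
    (h : ∃ C : ℝ≥0, ∀ e t, 0 ≤ t → t ≤ T →
      ∫⁻ x, ENNReal.ofReal (κ * (gradSq (u.1 e) x + u.1 e x ^ 2)) ∂μ t ≤ C * N e t) :
    u ∈ l2Bounded μ N T ∧ ∀ i, D i u ∈ l2Bounded μ N T := by
  obtain ⟨C, hC⟩ := h
  have key : ∀ v : SmoothFam ι, (∀ e x, v.1 e x ^ 2 ≤ gradSq (u.1 e) x + u.1 e x ^ 2) →
      v ∈ l2Bounded μ N T := by
    intro v hv
    refine ⟨Real.toNNReal κ⁻¹ * C, fun e t ht hT => ?_⟩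
    have hm : Measurable fun x =>
        ENNReal.ofReal (κ * (gradSq (u.1 e) x + u.1 e x ^ 2)) := by
      have c := (smoothFam_smooth u e).continuous
      have cp := fun i => (smooth_pd (smoothFam_smooth u e) i).continuous
      have c0 := cp 0
      have c1 := cp 1
      have c2 := cp 2
      have c3 := cp 3
      refine Continuous.measurable ?_ |>.ennreal_ofReal
      unfold gradSq
      fun_prop
    calc ∫⁻ x, ENNReal.ofReal (v.1 e x ^ 2) ∂μ t
        ≤ ∫⁻ x, ENNReal.ofReal κ⁻¹ *
            ENNReal.ofReal (κ * (gradSq (u.1 e) x + u.1 e x ^ 2)) ∂μ t := by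
          refine lintegral_mono fun x => ?_
          rw [← ENNReal.ofReal_mul (by positivity), inv_mul_cancel_left₀ hκ.ne']
          exact ENNReal.ofReal_le_ofReal (hv e x)
      _ = ENNReal.ofReal κ⁻¹ *
            ∫⁻ x, ENNReal.ofReal (κ * (gradSq (u.1 e) x + u.1 e x ^ 2)) ∂μ t :=
          lintegral_const_mul _ hm
      _ ≤ ENNReal.ofReal κ⁻¹ * (C * N e t) := by gcongr; exact hC e t ht hT
      _ = _ := by push_cast; rw [mul_assoc]; rfl
  refine ⟨key u fun e x => by linarith [gradSq_nonneg (u.1 e) x], fun i => key _ fun e x => ?_⟩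
  rw [D_apply]
  unfold gradSq
  fin_cases i <;> simp <;> nlinarith [sq_nonneg (pd 0 (u.1 e) x), sq_nonneg (pd 1 (u.1 e) x),
    sq_nonneg (pd 2 (u.1 e) x), sq_nonneg (pd 3 (u.1 e) x), sq_nonneg (u.1 e x)]

/-- A wave whose flux is bounded by the data is bounded by the data. -/
lemma mem_controlled_one_of_flux {δ c : ℝ} {K : ι → Coord 4 → ℝ} (hu : u ∈ waves ι)
    (hinit : u ∈ initControlled N T 1) (hδ : |δ| ≤ 1 / 2) (hc : 0 < c) (hc1 : c ≤ 1)
    (hK : ∀ e, Continuous (K e)) (hK0 : ∀ e x, 0 ≤ K e x)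
    (hflux : ∀ e x, normalFlux δ (u.1 e) x ≤ -c * gradSq (u.1 e) x + K e x)
    (hKN : ∃ C : ℝ≥0, ∀ e t, 0 ≤ t → t ≤ T →
      ∫⁻ x, ENNReal.ofReal (K e x) ∂sideMeasure t ≤ C * N e t) :
    u ∈ controlled N T 1 := by
  obtain ⟨C, hC⟩ := exists_bound_gradSq_init hinit
  obtain ⟨C', hC'⟩ := hKN
  have cG : ∀ e, Continuous fun x => gradSq (u.1 e) x + u.1 e x ^ 2 := by
    intro e
    have c := (smoothFam_smooth u e).continuous
    have cp := fun i => (smooth_pd (smoothFam_smooth u e) i).continuous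
    have c0 := cp 0
    have c1 := cp 1
    have c2 := cp 2
    have c3 := cp 3
    unfold gradSq
    fun_prop
  have mG : ∀ e (a : ℝ),
      Measurable fun x => ENNReal.ofReal (a * (gradSq (u.1 e) x + u.1 e x ^ 2)) :=
    fun e a => (continuous_const.mul (cG e)).measurable.ennreal_ofReal
  have key : ∀ e t, 0 ≤ t → t ≤ T →
      (∫⁻ x, ENNReal.ofReal (Real.exp (-4 * T) / 4 * (gradSq (u.1 e) x + u.1 e x ^ 2))
        ∂sliceMeasure t ≤ (C + C' : ℝ≥0) * N e t) ∧
      (∫⁻ x, ENNReal.ofReal (Real.exp (-4 * T) * c * (gradSq (u.1 e) x + u.1 e x ^ 2))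
        ∂sideMeasure t ≤ (C + C' : ℝ≥0) * N e t) := by
    intro e t ht hT
    have hb := energy_bound (smoothFam_smooth u e) (mem_waves.1 hu e) hδ hc hc1 (hK e) (hK0 e)
      (hflux e) ht hT
    have h1 := hC e t ht hT
    have h2 := hC' e t ht hT
    rw [lintegral_sliceMeasure (cG e).measurable.ennreal_ofReal] at h1
    rw [lintegral_sideMeasure (hK e).measurable.ennreal_ofReal] at h2
    rw [lintegral_sliceMeasure (mG e _), lintegral_sideMeasure (mG e _)]
    have h3 := add_le_add h1 h2
    rw [← add_mul] at h3
    push_cast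
    exact ⟨hb.1.trans h3, hb.2.trans h3⟩
  have s1 := mem_l2Bounded_of_gradSq (μ := sliceMeasure) (by positivity)
    ⟨C + C', fun e t ht hT => (key e t ht hT).1⟩
  have s2 := mem_l2Bounded_of_gradSq (μ := sideMeasure) (by positivity)
    ⟨C + C', fun e t ht hT => (key e t ht hT).2⟩
  exact mem_jets_one.2 ⟨⟨s1.1, s2.1⟩, fun i _ => ⟨s1.2 i, s2.2 i⟩⟩

/-- With `δ = -1/2` the flux contains `-(∂_1 u)² / 4`. Half of it absorbs the normal derivative in
`∂_0 u ∂_1 u`, the other half gives `c = 1/8`; what remains is tangential. -/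
lemma mem_controlled_one_of_dirichlet (hu : u ∈ waves ι) (hinit : u ∈ initControlled N T 1)
    (hside : u ∈ sideControlled N T 1) : u ∈ controlled N T 1 := by
  have hD := (mem_jets_one.1 hside).2
  obtain ⟨C0, h0⟩ := hD 0 (by simp)
  obtain ⟨C2, h2⟩ := hD 2 (by simp)
  obtain ⟨C3, h3⟩ := hD 3 (by simp)
  have cp := fun e i => (smooth_pd (smoothFam_smooth u e) i).continuous
  refine mem_controlled_one_of_flux (δ := -(1 / 2)) (c := 1 / 8)
    (K := fun e x => 2 * (pd 0 (u.1 e) x ^ 2 + pd 2 (u.1 e) x ^ 2 + pd 3 (u.1 e) x ^ 2))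
    hu hinit (by rw [abs_neg]; norm_num [abs_of_pos]) (by norm_num) (by norm_num) ?_ ?_ ?_ ?_
  · intro e
    have c0 := cp e 0
    have c2 := cp e 2
    have c3 := cp e 3
    fun_prop
  · intro e x; positivity
  · intro e x
    unfold normalFlux gradSq
    nlinarith [sq_nonneg (4 * pd 0 (u.1 e) x - pd 1 (u.1 e) x), sq_nonneg (pd 0 (u.1 e) x),
      sq_nonneg (pd 2 (u.1 e) x), sq_nonneg (pd 3 (u.1 e) x)]
  · refine ⟨2 * (C0 + C2 + C3), fun e t ht hT => ?_⟩
    have m := fun i => measurable_ofReal_sq (D i u) e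
    calc ∫⁻ x, ENNReal.ofReal
          (2 * (pd 0 (u.1 e) x ^ 2 + pd 2 (u.1 e) x ^ 2 + pd 3 (u.1 e) x ^ 2)) ∂sideMeasure t
        = ∫⁻ x, 2 * (ENNReal.ofReal ((D 0 u).1 e x ^ 2) + ENNReal.ofReal ((D 2 u).1 e x ^ 2)
            + ENNReal.ofReal ((D 3 u).1 e x ^ 2)) ∂sideMeasure t := by
          refine lintegral_congr fun x => ?_
          simp only [D_apply]
          rw [ENNReal.ofReal_mul (by norm_num), ENNReal.ofReal_add (by positivity) (by positivity),
            ENNReal.ofReal_add (by positivity) (by positivity)]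
          simp
      _ = 2 * (∫⁻ x, ENNReal.ofReal ((D 0 u).1 e x ^ 2) ∂sideMeasure t
            + ∫⁻ x, ENNReal.ofReal ((D 2 u).1 e x ^ 2) ∂sideMeasure t
            + ∫⁻ x, ENNReal.ofReal ((D 3 u).1 e x ^ 2) ∂sideMeasure t) := by
          rw [lintegral_const_mul' _ _ (by simp), lintegral_add_right _ (m 3),
            lintegral_add_right _ (m 2)]
      _ ≤ 2 * (C0 * N e t + C2 * N e t + C3 * N e t) := by
          gcongr
          exacts [h0 e t ht hT, h2 e t ht hT, h3 e t ht hT]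
      _ = _ := by push_cast; ring

/-- With `F = a + r b` known, `a b = F b - r b²` has the good term `-r b²`. A quarter of it absorbs
`F b`. The value of `δ` makes `δ (1 + 2 r²) = r`, so that `(3/4) δ (a² + b²)`, the flux term
together with the gradient to be gained, uses exactly the other three quarters up to multiples of
`F²`. -/
lemma sommerfeld_flux_le {r : ℝ} (hr : 0 < r) (a b c d : ℝ) :
    a * b + r / (1 + 2 * r ^ 2) / 2 * (a ^ 2 + b ^ 2 - c ^ 2 - d ^ 2)
      ≤ -(r / (1 + 2 * r ^ 2) / 4) * (a ^ 2 + b ^ 2 + c ^ 2 + d ^ 2)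
        + (1 / r + 2 * (r / (1 + 2 * r ^ 2))) * (a + r * b) ^ 2 := by
  set δ := r / (1 + 2 * r ^ 2) with hδ
  have hδ0 : 0 < δ := by positivity
  have hr' : δ * (1 + 2 * r ^ 2) = r := by rw [hδ]; field_simp
  obtain ⟨F, hF⟩ : ∃ F, a + r * b = F := ⟨_, rfl⟩
  have ha : a = F - r * b := by linarith
  rw [hF]
  have h1 : F * b ≤ 1 / r * F ^ 2 + r / 4 * b ^ 2 := by
    have : 0 ≤ (1 / r) * (F - r / 2 * b) ^ 2 := by positivity
    have h2 : (1 / r) * (F - r / 2 * b) ^ 2 = 1 / r * F ^ 2 - F * b + r / 4 * b ^ 2 := by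
      field_simp; ring
    linarith
  have h2 : a ^ 2 ≤ 2 * F ^ 2 + 2 * r ^ 2 * b ^ 2 := by
    rw [ha]; nlinarith [sq_nonneg (F + r * b)]
  have h3 : a * b = F * b - r * b ^ 2 := by rw [ha]; ring
  have h4 := mul_le_mul_of_nonneg_left h2 hδ0.le
  have h5 : δ * b ^ 2 + δ * (2 * r ^ 2 * b ^ 2) = r * b ^ 2 := by
    linear_combination b ^ 2 * hr'
  nlinarith [mul_nonneg hδ0.le (sq_nonneg c), mul_nonneg hδ0.le (sq_nonneg d),
    mul_nonneg hδ0.le (sq_nonneg F), mul_nonneg hr.le (sq_nonneg b)]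

lemma mem_controlled_one_of_sommerfeld {r : ℝ} (hr : 0 < r) (hu : u ∈ waves ι)
    (hinit : u ∈ initControlled N T 1)
    (hside : D 0 u + r • D 1 u ∈ sideControlled N T 0) : u ∈ controlled N T 1 := by
  obtain ⟨C, hC⟩ := hside
  have hden : 0 < 1 + 2 * r ^ 2 := by positivity
  have hδ0 : 0 < r / (1 + 2 * r ^ 2) := by positivity
  have hδ1 : r / (1 + 2 * r ^ 2) ≤ 1 / 2 := by
    rw [div_le_div_iff₀ hden (by norm_num)]; nlinarith [sq_nonneg (r - 1)]
  refine mem_controlled_one_of_flux (δ := r / (1 + 2 * r ^ 2)) (c := r / (1 + 2 * r ^ 2) / 4)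
    (K := fun e x => (1 / r + 2 * (r / (1 + 2 * r ^ 2))) * (pd 0 (u.1 e) x + r * pd 1 (u.1 e) x) ^ 2)
    hu hinit (by rwa [abs_of_pos hδ0]) (by positivity) (by linarith) ?_ ?_ ?_ ?_
  · intro e
    have c0 := (smooth_pd (smoothFam_smooth u e) 0).continuous
    have c1 := (smooth_pd (smoothFam_smooth u e) 1).continuous
    fun_prop
  · intro e x; positivity
  · intro e x
    exact sommerfeld_flux_le hr _ _ _ _
  · refine ⟨Real.toNNReal (1 / r + 2 * (r / (1 + 2 * r ^ 2))) * C, fun e t ht hT => ?_⟩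
    have := hC e t ht hT
    calc ∫⁻ x, ENNReal.ofReal ((1 / r + 2 * (r / (1 + 2 * r ^ 2)))
            * (pd 0 (u.1 e) x + r * pd 1 (u.1 e) x) ^ 2) ∂sideMeasure t
        = ∫⁻ x, ENNReal.ofReal (1 / r + 2 * (r / (1 + 2 * r ^ 2))) *
            ENNReal.ofReal ((D 0 u + r • D 1 u).1 e x ^ 2) ∂sideMeasure t := by
          refine lintegral_congr fun x => ?_
          rw [ENNReal.ofReal_mul (by positivity)]
          rfl
      _ = ENNReal.ofReal (1 / r + 2 * (r / (1 + 2 * r ^ 2))) *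
            ∫⁻ x, ENNReal.ofReal ((D 0 u + r • D 1 u).1 e x ^ 2) ∂sideMeasure t :=
          lintegral_const_mul _ (measurable_ofReal_sq _ e)
      _ ≤ ENNReal.ofReal (1 / r + 2 * (r / (1 + 2 * r ^ 2))) * (C * N e t) := by gcongr
      _ = _ := by push_cast; rw [mul_assoc]; rfl

/-! ### Higher order estimates -/

/-- The wave equation recovers the normal derivatives from the tangential ones. -/
lemma mem_controlled_of_tangential (hu : u ∈ waves ι) (h1 : u ∈ controlled N T 1)
    (ht : ∀ i, i ≠ 1 → D i u ∈ controlled N T k) : u ∈ controlled N T (k + 1) := by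
  refine mem_jets_succ.2 ⟨jets_le_base _ _ _ h1, fun i _ => ?_⟩
  by_cases hi : i = 1
  · subst hi
    have hD1 := D_mem_jets h1 (mem_univ (1 : Fin 4))
    cases k with
    | zero => exact hD1
    | succ k =>
      refine mem_jets_succ.2 ⟨jets_le_base _ _ _ hD1, fun j _ => ?_⟩
      have hD : ∀ j i, j ≠ 1 → D i (D j u) ∈ controlled N T k :=
        fun j i hj => D_mem_jets (ht j hj) (mem_univ i)
      by_cases hj : j = 1
      · subst hj
        -- The only second derivative without a tangential factor is `∂_1² u`, which the wave
        -- equation expresses by the others.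
        have hbox : boxFam u ∈ controlled N T k := vanishing_corner_le_controlled hu
        have heq : D 1 (D 1 u) = boxFam u + D 0 (D 0 u) - D 2 (D 2 u) - D 3 (D 3 u) := by
          rw [boxFam_eq]; abel
        rw [heq]
        exact sub_mem (sub_mem (add_mem hbox (hD 0 0 (by simp))) (hD 2 2 (by simp)))
          (hD 3 3 (by simp))
      · rw [D_comm]
        exact hD j 1 hj
  · exact ht i hi

/-- Estimate for waves with controlled Dirichlet data. -/
theorem mem_controlled_of_dirichlet (hu : u ∈ waves ι) (hinit : u ∈ initControlled N T (k + 1))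
    (hside : u ∈ sideControlled N T (k + 1)) : u ∈ controlled N T (k + 1) := by
  induction k generalizing u with
  | zero => exact mem_controlled_one_of_dirichlet hu hinit hside
  | succ k ih =>
    have hle : 0 + 1 ≤ k + 1 + 1 := by omega
    refine mem_controlled_of_tangential hu (mem_controlled_one_of_dirichlet hu
      (jets_antitone hle hinit) (jets_antitone hle hside)) fun i hi => ?_
    exact ih (D_mem_waves hu i) (D_mem_jets hinit (mem_univ i)) (D_mem_jets hside hi)

/-- Estimate for waves with a controlled boundary value of `∂_0 u + r ∂_1 u`. -/
theorem mem_controlled_of_sommerfeld {r : ℝ} (hr : 0 < r) (hu : u ∈ waves ι)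
    (hinit : u ∈ initControlled N T (k + 1))
    (hside : D 0 u + r • D 1 u ∈ sideControlled N T k) : u ∈ controlled N T (k + 1) := by
  induction k generalizing u with
  | zero => exact mem_controlled_one_of_sommerfeld hr hu hinit hside
  | succ k ih =>
    refine mem_controlled_of_tangential hu (mem_controlled_one_of_sommerfeld hr hu
      -- The boundary operator has constant coefficients and so commutes with tangential
      -- derivatives, which are again waves.
      (jets_antitone (by omega) hinit) (jets_le_base _ _ _ hside)) fun i hi => ?_
    refine ih (D_mem_waves hu i) (D_mem_jets hinit (mem_univ i)) ?_
    have := D_mem_jets hside hi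
    rwa [map_add, map_smul, D_comm i 0, D_comm i 1] at this

/-! ### Jets and the Sobolev norms of the statement -/

lemma jetSq_nonneg {n : ℕ} (s : ℕ) (u : Coord n → ℝ) (x : Coord n) : 0 ≤ jetSq s u x := by
  induction s generalizing u with
  | zero => exact sq_nonneg _
  | succ s ih => exact add_nonneg (sq_nonneg _) (Finset.sum_nonneg fun i _ => ih _)

lemma sq_le_jetSq {n : ℕ} (s : ℕ) (u : Coord n → ℝ) (x : Coord n) : u x ^ 2 ≤ jetSq s u x := by
  cases s with
  | zero => exact le_rfl
  | succ s => exact le_add_of_nonneg_right (Finset.sum_nonneg fun i _ => jetSq_nonneg s _ x)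

lemma jetSq_pd_le {n : ℕ} (s : ℕ) (u : Coord n → ℝ) (i : Fin n) (x : Coord n) :
    jetSq s (pd i u) x ≤ jetSq (s + 1) u x := by
  have h1 : jetSq s (pd i u) x ≤ ∑ i, jetSq s (pd i u) x :=
    Finset.single_le_sum (f := fun i => jetSq s (pd i u) x) (fun i _ => jetSq_nonneg s _ x)
      (Finset.mem_univ i)
  exact h1.trans (le_add_of_nonneg_left (sq_nonneg _))

lemma continuous_jetSq {n : ℕ} (s : ℕ) {u : Coord n → ℝ} (hu : ContDiff ℝ ∞ u) :
    Continuous (jetSq s u) := by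
  induction s generalizing u with
  | zero => exact hu.continuous.pow 2
  | succ s ih =>
    exact (hu.continuous.pow 2).add (continuous_finsetSum _ fun i _ => ih (smooth_pd hu i))

/-- Control of all derivatives bounds the integral of the jets. -/
lemma exists_bound_jetSq {μ : ℝ → Measure (Coord 4)}
    (hu : u ∈ jets univ (l2Bounded μ N T) k) :
    ∃ C : ℝ≥0, ∀ e t, 0 ≤ t → t ≤ T →
      ∫⁻ x, ENNReal.ofReal (jetSq k (u.1 e) x) ∂μ t ≤ C * N e t := by
  induction k generalizing u with
  | zero => exact hu
  | succ k ih =>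
    obtain ⟨⟨C, hC⟩, hD⟩ := mem_jets_succ.1 hu
    choose C' hC' using fun i => ih (hD i (mem_univ i))
    refine ⟨C + ∑ i, C' i, fun e t ht hT => ?_⟩
    have m : ∀ i, Measurable fun x => ENNReal.ofReal (jetSq k (pd i (u.1 e)) x) := fun i =>
      (continuous_jetSq k (smooth_pd (smoothFam_smooth u e) i)).measurable.ennreal_ofReal
    calc ∫⁻ x, ENNReal.ofReal (jetSq (k + 1) (u.1 e) x) ∂μ t
        = ∫⁻ x, (ENNReal.ofReal (u.1 e x ^ 2)
            + ∑ i, ENNReal.ofReal (jetSq k (pd i (u.1 e)) x)) ∂μ t := by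
          refine lintegral_congr fun x => ?_
          rw [jetSq, ENNReal.ofReal_add (sq_nonneg _)
            (Finset.sum_nonneg fun i _ => jetSq_nonneg k _ x),
            ENNReal.ofReal_sum_of_nonneg fun i _ => jetSq_nonneg k _ x]
      _ = ∫⁻ x, ENNReal.ofReal (u.1 e x ^ 2) ∂μ t
            + ∑ i, ∫⁻ x, ENNReal.ofReal (jetSq k (pd i (u.1 e)) x) ∂μ t := by
          rw [lintegral_add_left (measurable_ofReal_sq u e), lintegral_finsetSum _ fun i _ => m i]
      _ ≤ C * N e t + ∑ i, C' i * N e t := by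
          gcongr with i
          · exact hC e t ht hT
          · exact hC' i e t ht hT
      _ = _ := by rw [← Finset.sum_mul, ← add_mul]; push_cast; rfl

lemma mem_jets_of_bound {μ : ℝ → Measure (Coord 4)}
    (hu : ∀ e t, 0 ≤ t → t ≤ T → ∫⁻ x, ENNReal.ofReal (jetSq k (u.1 e) x) ∂μ t ≤ N e t) :
    u ∈ jets univ (l2Bounded μ N T) k := by
  have base : ∀ (k : ℕ) (u : SmoothFam ι), (∀ e t, 0 ≤ t → t ≤ T →
      ∫⁻ x, ENNReal.ofReal (jetSq k (u.1 e) x) ∂μ t ≤ N e t) → u ∈ l2Bounded μ N T :=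
    fun k u hu => ⟨1, fun e t ht hT => by
      rw [ENNReal.coe_one, one_mul]
      exact (lintegral_mono fun x => ENNReal.ofReal_le_ofReal (sq_le_jetSq k _ x)).trans
        (hu e t ht hT)⟩
  induction k generalizing u with
  | zero => exact base 0 u hu
  | succ k ih =>
    refine mem_jets_succ.2 ⟨base _ u hu, fun i _ => ih fun e t ht hT => ?_⟩
    exact (lintegral_mono fun x => ENNReal.ofReal_le_ofReal (jetSq_pd_le k _ i x)).trans
      (hu e t ht hT)

/-- Functions with boundary values of bounded Sobolev norm are controlled on the side. -/
lemma mem_sideControlled_of_data {b : ι → Coord 3 → ℝ}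
    (hb : ∀ e t, 0 ≤ t → t ≤ T → normSqSide k t (b e) ≤ N e t)
    (hub : ∀ e (y : Coord 3), 0 < y 0 → u.1 e (sidePt y) = b e y) :
    u ∈ sideControlled N T k := by
  have base : ∀ (k : ℕ) (u : SmoothFam ι) (b : ι → Coord 3 → ℝ),
      (∀ e t, 0 ≤ t → t ≤ T → normSqSide k t (b e) ≤ N e t) →
      (∀ e (y : Coord 3), 0 < y 0 → u.1 e (sidePt y) = b e y) →
      u ∈ l2Bounded sideMeasure N T := by
    intro k u b hb hub
    refine ⟨1, fun e t ht hT => ?_⟩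
    rw [ENNReal.coe_one, one_mul, lintegral_sideMeasure (measurable_ofReal_sq u e)]
    refine le_trans (lintegral_mono_ae ?_) (hb e t ht hT)
    filter_upwards [ae_side_pos t] with y hy
    rw [hub e y hy]
    exact ENNReal.ofReal_le_ofReal (sq_le_jetSq k _ y)
  induction k generalizing u b with
  | zero => exact base 0 u b hb hub
  | succ k ih =>
    refine mem_jets_succ.2 ⟨base _ u b hb hub, fun i hi => ?_⟩
    obtain ⟨j, rfl⟩ := exists_sideIdx hi
    refine ih (b := fun e => pd j (b e)) (fun e t ht hT => ?_) fun e y hy => ?_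
    · exact (lintegral_mono fun y => ENNReal.ofReal_le_ofReal (jetSq_pd_le k _ j y)).trans
        (hb e t ht hT)
    · rw [D_apply, ← pd_comp_sidePt (smoothFam_differentiable u e)]
      -- The two functions agree near `y`, as `y 0 > 0` is an open condition. The data need not be
      -- assumed differentiable: where they matter they are restrictions of smooth functions.
      refine pd_congr_of_eventuallyEq ?_
      have hopen : IsOpen {y : Coord 3 | 0 < y 0} :=
        isOpen_lt continuous_const (continuous_apply 0)
      filter_upwards [hopen.mem_nhds hy] with z hz
      exact hub e z hz

/-! ### Linearization of the gauge field and of the mean curvatures -/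

/-- The background metric is constant, so the quantities to be linearized are exactly `ε` times a
function continuous at 0. Neither matrix inverses nor square roots need to be differentiated. -/
lemma linearization_of_eq_mul {Q : MatField → Coord 4 → ℝ} {h : MatField} {x : Coord 4}
    {f : ℝ → ℝ} (hQ : ∀ ε, Q (fun y => minkowski + ε • h y) x = ε * f ε)
    (hf : ContinuousAt f 0) : linearization Q h x = f 0 := by
  unfold linearization
  simp only [hQ]
  refine HasDerivAt.deriv ?_
  rw [hasDerivAt_iff_tendsto_slope]
  refine (hf.tendsto.mono_left nhdsWithin_le_nhds).congr' ?_
  filter_upwards [self_mem_nhdsWithin] with ε hε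
  simp only [slope_def_field, zero_mul, sub_zero]
  rw [mul_div_cancel_left₀ _ hε]

lemma continuousAt_inv_perturb {m : ℕ} {A B : Matrix (Fin m) (Fin m) ℝ} (hA : A.det ≠ 0)
    (i j : Fin m) : ContinuousAt (fun ε : ℝ => (A + ε • B)⁻¹ i j) 0 := by
  have h1 : ContinuousAt (fun ε : ℝ => (A + ε • B)⁻¹) 0 := by
    refine ContinuousAt.comp (g := fun M : Matrix (Fin m) (Fin m) ℝ => M⁻¹)
      (f := fun ε : ℝ => A + ε • B) ?_ (by fun_prop)
    refine continuousAt_matrix_inv _ ?_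
    simp only [zero_smul, add_zero]
    rw [Ring.inverse_eq_inv']
    exact continuousAt_inv₀ hA
  exact (continuous_apply_apply i j).continuousAt.comp h1

lemma inv_eq_self_of_sq {m : ℕ} {A : Matrix (Fin m) (Fin m) ℝ} (hA : A * A = 1) : A⁻¹ = A :=
  Matrix.inv_eq_left_inv hA

lemma det_ne_zero_of_sq {m : ℕ} {A : Matrix (Fin m) (Fin m) ℝ} (hA : A * A = 1) : A.det ≠ 0 := by
  intro h
  have := congrArg Matrix.det hA
  rw [Matrix.det_mul, h] at this
  simp at this

lemma minkowski_submatrix_sq {m : ℕ} {e : Fin m → Fin 4} (he : Function.Injective e) :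
    minkowski.submatrix e e * minkowski.submatrix e e = 1 := by
  rw [minkowski, Matrix.submatrix_diagonal _ _ he, Matrix.diagonal_mul_diagonal,
    ← Matrix.diagonal_one]
  congr 1
  funext i
  have : ∀ j : Fin 4, (![-1, 1, 1, 1] : Fin 4 → ℝ) j * (![-1, 1, 1, 1] : Fin 4 → ℝ) j = 1 := by
    intro j; fin_cases j <;> simp
  exact this (e i)

lemma minkowski_sq : minkowski * minkowski = 1 := by
  simpa using minkowski_submatrix_sq (e := id) Function.injective_id

/-- The Christoffel symbols of `η + ε h`, divided by `ε`. -/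
def scaledChristoffel (h : MatField) (x : Coord 4) (l i j : Fin 4) (ε : ℝ) : ℝ :=
  (1 / 2) * ∑ m, (minkowski + ε • h x)⁻¹ l m *
    (pd i (fun y => h y m j) x + pd j (fun y => h y m i) x - pd m (fun y => h y i j) x)


lemma christoffel_perturb {h : MatField} (hs : ∀ i j, ContDiff ℝ ∞ (fun x => h x i j))
    (x : Coord 4) (l i j : Fin 4) (ε : ℝ) :
    christoffel (fun y => minkowski + ε • h y) l i j x = ε * scaledChristoffel h x l i j ε := by
  have hpd : ∀ k i j, pd k (fun y => (minkowski + ε • h y) i j) x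
      = ε * pd k (fun y => h y i j) x := by
    intro k i j
    have hd : DifferentiableAt ℝ (fun y => h y i j) x := ((hs i j).differentiable (by simp)) x
    simp only [Matrix.add_apply, Matrix.smul_apply, smul_eq_mul]
    rw [pd_add (by fun_prop) (by fun_prop), pd_const, pd_const_mul _ hd, zero_add]
  unfold christoffel scaledChristoffel
  simp only [hpd, Finset.mul_sum]
  exact Finset.sum_congr rfl fun m _ => by ring

lemma continuousAt_scaledChristoffel (x : Coord 4) (h : MatField) (l i j : Fin 4) :
    ContinuousAt (scaledChristoffel h x l i j) 0 := by
  unfold scaledChristoffel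
  have hc := fun l m => continuousAt_inv_perturb (B := h x) (det_ne_zero_of_sq minkowski_sq) l m
  exact continuousAt_const.mul (tendsto_finsetSum _ fun m _ => (hc l m).mul continuousAt_const)

lemma scaledChristoffel_zero (x : Coord 4) (h : MatField) (l i j : Fin 4) :
    scaledChristoffel h x l i j 0 = (1 / 2) * ((![-1, 1, 1, 1] : Fin 4 → ℝ) l *
      (pd i (fun y => h y l j) x + pd j (fun y => h y l i) x - pd l (fun y => h y i j) x)) := by
  unfold scaledChristoffel
  rw [zero_smul, add_zero, inv_eq_self_of_sq minkowski_sq, Finset.sum_eq_single l]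
  · simp [minkowski]
  · intro m _ hm
    simp [minkowski, Matrix.diagonal_apply_ne' _ hm]
  · simp

lemma linearization_gaugeField {h : MatField} (hs : ∀ i j, ContDiff ℝ ∞ (fun x => h x i j))
    (x : Coord 4) (a : Fin 4) :
    linearization (gaugeField a) h x
      = -(-scaledChristoffel h x a 0 0 0 + scaledChristoffel h x a 1 1 0
        + scaledChristoffel h x a 2 2 0 + scaledChristoffel h x a 3 3 0) := by
  have key := linearization_of_eq_mul (Q := gaugeField a) (h := h) (x := x)
    (f := fun ε => ∑ i, ∑ j, (minkowski + ε • h x)⁻¹ i j * (-scaledChristoffel h x a i j ε)) ?_ ?_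
  · rw [key]
    simp only [zero_smul, add_zero, inv_eq_self_of_sq minkowski_sq, Fin.sum_univ_four]
    simp [minkowski]
    ring
  · intro ε
    -- Second derivatives of a coordinate vanish, hence `□_g x^a = -g^{ij} Γ^a_{ij}`.
    have hcoord : ∀ j : Fin 4, pd j (fun y : Coord 4 => y a) = fun _ => if a = j then 1 else 0 :=
      fun j => funext fun y => pd_coord j a y
    unfold gaugeField box
    simp only [hcoord, pd_const, christoffel_perturb hs x, Finset.mul_sum]
    refine Finset.sum_congr rfl fun i _ => Finset.sum_congr rfl fun j _ => ?_
    simp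
    ring
  · refine tendsto_finsetSum _ fun i _ => tendsto_finsetSum _ fun j _ => ?_
    exact (continuousAt_inv_perturb (det_ne_zero_of_sq minkowski_sq) i j).mul
      (continuousAt_scaledChristoffel x h a i j).neg

lemma continuousAt_traceOn (x : Coord 4) {m : ℕ} {e : Fin m → Fin 4} (he : Function.Injective e) (h : MatField)
    {K : ℝ → Matrix (Fin 4) (Fin 4) ℝ} (hK : ∀ i j, ContinuousAt (fun ε => K ε i j) 0) :
    ContinuousAt (fun ε => traceOn e (minkowski + ε • h x) (K ε)) 0 := by
  unfold traceOn
  refine tendsto_finsetSum _ fun i _ => tendsto_finsetSum _ fun j _ => ?_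
  refine ContinuousAt.mul ?_ (hK _ _)
  exact continuousAt_inv_perturb (B := (h x).submatrix e e)
    (det_ne_zero_of_sq (minkowski_submatrix_sq he)) i j

lemma traceOn_smul {m : ℕ} (e : Fin m → Fin 4) (G K : Matrix (Fin 4) (Fin 4) ℝ) (ε : ℝ) :
    traceOn e G (ε • K) = ε * traceOn e G K := by
  simp only [traceOn, Finset.mul_sum, Matrix.smul_apply, smul_eq_mul]
  exact Finset.sum_congr rfl fun i _ => Finset.sum_congr rfl fun j _ => by ring

lemma traceOn_minkowski {m : ℕ} {e : Fin m → Fin 4} (he : Function.Injective e)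
    (K : Matrix (Fin 4) (Fin 4) ℝ) :
    traceOn e minkowski K = ∑ i, (![-1, 1, 1, 1] : Fin 4 → ℝ) (e i) * K (e i) (e i) := by
  unfold traceOn
  rw [inv_eq_self_of_sq (minkowski_submatrix_sq he)]
  refine Finset.sum_congr rfl fun i _ => ?_
  rw [Finset.sum_eq_single i]
  · simp [minkowski]
  · intro j _ hj
    simp [minkowski, Matrix.diagonal_apply_ne' _ (fun hij => hj (he hij))]
  · simp

lemma linearization_meanCurv {h : MatField} (hs : ∀ i j, ContDiff ℝ ∞ (fun x => h x i j))
    (x : Coord 4) (α β : ℝ) :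
    linearization (meanCurv α β) h x
      = α * (scaledChristoffel h x 0 2 2 0 + scaledChristoffel h x 0 3 3 0)
        + (α + β + 1) * (-scaledChristoffel h x 1 0 0 0 + scaledChristoffel h x 1 2 2 0
          + scaledChristoffel h x 1 3 3 0)
        - (α + 1) * (scaledChristoffel h x 1 2 2 0 + scaledChristoffel h x 1 3 3 0) := by
  have e2 : Function.Injective (![2, 3] : Fin 2 → Fin 4) := by decide
  have e3 : Function.Injective (![0, 2, 3] : Fin 3 → Fin 4) := by decide
  set Kt : ℝ → Matrix (Fin 4) (Fin 4) ℝ := fun ε i j =>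
    scaledChristoffel h x 0 i j ε / √(-(minkowski + ε • h x)⁻¹ 0 0) with hKt
  set Ks : ℝ → Matrix (Fin 4) (Fin 4) ℝ := fun ε i j =>
    -scaledChristoffel h x 1 i j ε / √((minkowski + ε • h x)⁻¹ 1 1) with hKs
  have m0 : -(minkowski + (0 : ℝ) • h x)⁻¹ 0 0 = 1 := by
    rw [zero_smul, add_zero, inv_eq_self_of_sq minkowski_sq]; simp [minkowski]
  have m1 : (minkowski + (0 : ℝ) • h x)⁻¹ 1 1 = 1 := by
    rw [zero_smul, add_zero, inv_eq_self_of_sq minkowski_sq]; simp [minkowski]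
  have t0 : ∀ i j, Kt 0 i j = scaledChristoffel h x 0 i j 0 := fun i j => by
    simp only [hKt, m0, Real.sqrt_one, div_one]
  have s0 : ∀ i j, Ks 0 i j = -scaledChristoffel h x 1 i j 0 := fun i j => by
    simp only [hKs, m1, Real.sqrt_one, div_one]
  have cKt : ∀ i j, ContinuousAt (fun ε => Kt ε i j) 0 := fun i j =>
    (continuousAt_scaledChristoffel x h 0 i j).div
      (Real.continuous_sqrt.continuousAt.comp
        (continuousAt_inv_perturb (det_ne_zero_of_sq minkowski_sq) 0 0).neg)
      (by change √(-(minkowski + (0 : ℝ) • h x)⁻¹ 0 0) ≠ 0; rw [m0]; simp)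
  have cKs : ∀ i j, ContinuousAt (fun ε => Ks ε i j) 0 := fun i j =>
    (continuousAt_scaledChristoffel x h 1 i j).neg.div
      (Real.continuous_sqrt.continuousAt.comp
        (continuousAt_inv_perturb (det_ne_zero_of_sq minkowski_sq) 1 1))
      (by change √((minkowski + (0 : ℝ) • h x)⁻¹ 1 1) ≠ 0; rw [m1]; simp)
  have key := linearization_of_eq_mul (Q := meanCurv α β) (h := h) (x := x)
    (f := fun ε => α * traceOn ![2, 3] (minkowski + ε • h x) (Kt ε)
      - (α + β + 1) * traceOn ![0, 2, 3] (minkowski + ε • h x) (Ks ε)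
      + (α + 1) * traceOn ![2, 3] (minkowski + ε • h x) (Ks ε)) ?_ ?_
  · rw [key]
    simp only [zero_smul, add_zero, traceOn_minkowski e2, traceOn_minkowski e3,
      Fin.sum_univ_two, Fin.sum_univ_three]
    simp only [t0, s0]
    simp
    ring
  · intro ε
    have st : secondFormTime (fun y => minkowski + ε • h y) x = ε • Kt ε := by
      ext i j
      rw [Matrix.smul_apply, smul_eq_mul]
      simp only [secondFormTime, christoffel_perturb hs x, hKt]
      ring
    have ss : secondFormSide (fun y => minkowski + ε • h y) x = ε • Ks ε := by
      ext i j
      rw [Matrix.smul_apply, smul_eq_mul]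
      simp only [secondFormSide, christoffel_perturb hs x, hKs]
      ring
    simp only [meanCurv, st, ss, traceOn_smul]
    ring
  · exact ((continuousAt_const.mul (continuousAt_traceOn x e2 h cKt)).sub
      (continuousAt_const.mul (continuousAt_traceOn x e3 h cKs))).add
      (continuousAt_const.mul (continuousAt_traceOn x e2 h cKs))

/-! ### The linear systems for families -/

/-- The linearized gauge field `∂^β h_{aβ} - ∂_a (tr h) / 2`. -/
def gaugeFam (h : Fin 4 → Fin 4 → SmoothFam ι) (a : Fin 4) : SmoothFam ι :=
  -D 0 (h a 0) + D 1 (h a 1) + D 2 (h a 2) + D 3 (h a 3)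
    - (1 / 2 : ℝ) • D a (-h 0 0 + h 1 1 + h 2 2 + h 3 3)

/-- The linearized combination of mean curvatures. -/
def meanCurvFam (α β : ℝ) (h : Fin 4 → Fin 4 → SmoothFam ι) : SmoothFam ι :=
  α • ((1 / 2 : ℝ) • D 0 (h 2 2 + h 3 3) - D 2 (h 0 2) - D 3 (h 0 3))
    - (α + β + 1) • (D 0 (h 0 1) - (1 / 2 : ℝ) • D 1 (h 0 0) - D 2 (h 1 2) - D 3 (h 1 3)
      + (1 / 2 : ℝ) • D 1 (h 2 2 + h 3 3))
    + (α + 1) • (-D 2 (h 1 2) - D 3 (h 1 3) + (1 / 2 : ℝ) • D 1 (h 2 2 + h 3 3))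

/-- The hypotheses shared by both systems, for families of tensors. -/
structure GaugedFam (N : ι → ℝ → ℝ≥0∞) (T : ℝ) (k : ℕ) (h : Fin 4 → Fin 4 → SmoothFam ι) :
    Prop where
  symm : ∀ i j, h i j = h j i
  wave : ∀ i j, h i j ∈ waves ι
  init : ∀ i j, h i j ∈ initControlled N T (k + 1)
  gauge : ∀ a, gaugeFam h a ∈ vanishing ι openSide
  side_c₂ : h 2 2 - h 3 3 ∈ sideControlled N T (k + 1)
  side_c₃ : h 2 3 ∈ sideControlled N T (k + 1)
  side_b₀ : (1 / 2 : ℝ) • h 0 0 + h 0 1 ∈ sideControlled N T (k + 1)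
  side_b₂ : h 0 2 + h 1 2 ∈ sideControlled N T (k + 1)
  side_b₃ : h 0 3 + h 1 3 ∈ sideControlled N T (k + 1)

lemma D_mem_controlled (hu : u ∈ controlled N T (k + 1)) (i : Fin 4) :
    D i u ∈ controlled N T k := D_mem_jets hu (mem_univ i)

lemma D_mem_initControlled (hu : u ∈ initControlled N T (k + 1)) (i : Fin 4) :
    D i u ∈ initControlled N T k := D_mem_jets hu (mem_univ i)

namespace GaugedFam

variable {h : Fin 4 → Fin 4 → SmoothFam ι}

/-- The wave equation is flat and componentwise, so each of these constant combinations is a scalar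
wave with Dirichlet data. -/
lemma controlled_of_dirichlet_data (H : GaugedFam N T k h) :
    h 2 2 - h 3 3 ∈ controlled N T (k + 1) ∧ h 2 3 ∈ controlled N T (k + 1) ∧
    (1 / 2 : ℝ) • h 0 0 + h 0 1 ∈ controlled N T (k + 1) ∧
    h 0 2 + h 1 2 ∈ controlled N T (k + 1) ∧ h 0 3 + h 1 3 ∈ controlled N T (k + 1) :=
  ⟨mem_controlled_of_dirichlet (sub_mem (H.wave _ _) (H.wave _ _))
      (sub_mem (H.init _ _) (H.init _ _)) H.side_c₂,
    mem_controlled_of_dirichlet (H.wave _ _) (H.init _ _) H.side_c₃,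
    mem_controlled_of_dirichlet (add_mem (Submodule.smul_mem _ _ (H.wave _ _)) (H.wave _ _))
      (add_mem (Submodule.smul_mem _ _ (H.init _ _)) (H.init _ _)) H.side_b₀,
    mem_controlled_of_dirichlet (add_mem (H.wave _ _) (H.wave _ _))
      (add_mem (H.init _ _) (H.init _ _)) H.side_b₂,
    mem_controlled_of_dirichlet (add_mem (H.wave _ _) (H.wave _ _))
      (add_mem (H.init _ _) (H.init _ _)) H.side_b₃⟩

/-- The tensor is recovered from the unknowns for which the boundary conditions decouple. -/
lemma controlled_of_unknowns (H : GaugedFam N T k h)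
    (hq : h 0 1 ∈ controlled N T (k + 1)) (hp : h 1 1 ∈ controlled N T (k + 1))
    (hw : (1 / 2 : ℝ) • (h 2 2 + h 3 3) ∈ controlled N T (k + 1))
    (h2 : h 1 2 ∈ controlled N T (k + 1)) (h3 : h 1 3 ∈ controlled N T (k + 1)) (i j : Fin 4) :
    h i j ∈ controlled N T (k + 1) := by
  obtain ⟨hc2, hc3, hb0, hb2, hb3⟩ := H.controlled_of_dirichlet_data
  have h00 : h 0 0 ∈ controlled N T (k + 1) := by
    have : h 0 0 = (2 : ℝ) • ((1 / 2 : ℝ) • h 0 0 + h 0 1) - (2 : ℝ) • h 0 1 := by module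
    rw [this]
    exact sub_mem (Submodule.smul_mem _ _ hb0) (Submodule.smul_mem _ _ hq)
  have h02 : h 0 2 ∈ controlled N T (k + 1) := by simpa using sub_mem hb2 h2
  have h03 : h 0 3 ∈ controlled N T (k + 1) := by simpa using sub_mem hb3 h3
  have h22 : h 2 2 ∈ controlled N T (k + 1) := by
    have : h 2 2 = (1 / 2 : ℝ) • (h 2 2 + h 3 3) + (1 / 2 : ℝ) • (h 2 2 - h 3 3) := by module
    rw [this]
    exact add_mem hw (Submodule.smul_mem _ _ hc2)
  have h33 : h 3 3 ∈ controlled N T (k + 1) := by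
    have : h 3 3 = (1 / 2 : ℝ) • (h 2 2 + h 3 3) - (1 / 2 : ℝ) • (h 2 2 - h 3 3) := by module
    rw [this]
    exact sub_mem hw (Submodule.smul_mem _ _ hc2)
  fin_cases i <;> fin_cases j
  exacts [h00, hq, h02, h03, H.symm 0 1 ▸ hq, hp, h2, h3, H.symm 0 2 ▸ h02, H.symm 1 2 ▸ h2, h22,
    hc3, H.symm 0 3 ▸ h03, H.symm 1 3 ▸ h3, H.symm 2 3 ▸ hc3, h33]

/-- The system with Dirichlet, conformal and gauge boundary conditions. -/
theorem controlled_of_dirichlet_system (H : GaugedFam N T k h)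
    (side_b₁ : h 0 1 + (1 / 2 : ℝ) • h 1 1 ∈ sideControlled N T (k + 1)) (i j : Fin 4) :
    h i j ∈ controlled N T (k + 1) := by
  obtain ⟨hc2, hc3, hb0, hb2, hb3⟩ := H.controlled_of_dirichlet_data
  have hb1 : h 0 1 + (1 / 2 : ℝ) • h 1 1 ∈ controlled N T (k + 1) :=
    mem_controlled_of_dirichlet (add_mem (H.wave _ _) (Submodule.smul_mem _ _ (H.wave _ _)))
      (add_mem (H.init _ _) (Submodule.smul_mem _ _ (H.init _ _))) side_b₁
  have hG : ∀ a, gaugeFam h a ∈ sideControlled N T k := fun a =>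
    vanishing_openSide_le_sideControlled (H.gauge a)
  have s10 := H.symm 1 0
  have s20 := H.symm 2 0
  have s21 := H.symm 2 1
  have s30 := H.symm 3 0
  have s31 := H.symm 3 1
  have s32 := H.symm 3 2
  have hd : ∀ {u : SmoothFam ι} (i : Fin 4), u ∈ controlled N T (k + 1) →
      D i u ∈ sideControlled N T k := fun i hu =>
    controlled_le_sideControlled (D_mem_controlled hu i)
  have hQ2 : h 1 2 ∈ controlled N T (k + 1) := by
    refine mem_controlled_of_sommerfeld one_pos (H.wave _ _) (H.init _ _) ?_
    -- In the gauge equation with index 2 the part `(h_11 - h_00) / 2` of the trace term equals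
    -- `(h_01 + h_11 / 2) - (h_00 / 2 + h_01)`, a difference of controlled waves, and `h_22 + h_33`
    -- cancels against `∂_2 h_22` up to `h_22 - h_33`.
    have : D 0 (h 1 2) + (1 : ℝ) • D 1 (h 1 2) = gaugeFam h 2 + D 0 (h 0 2 + h 1 2)
        - (1 / 2 : ℝ) • D 2 (h 2 2 - h 3 3) - D 3 (h 2 3)
        + D 2 (h 0 1 + (1 / 2 : ℝ) • h 1 1) - D 2 ((1 / 2 : ℝ) • h 0 0 + h 0 1) := by
      simp only [gaugeFam, map_add, map_sub, map_neg, map_smul, s20, s21]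
      module
    rw [this]
    exact sub_mem (add_mem (sub_mem (sub_mem (add_mem (hG 2) (hd 0 hb2))
      (Submodule.smul_mem _ _ (hd 2 hc2))) (hd 3 hc3)) (hd 2 hb1)) (hd 2 hb0)
  have hQ3 : h 1 3 ∈ controlled N T (k + 1) := by
    refine mem_controlled_of_sommerfeld one_pos (H.wave _ _) (H.init _ _) ?_
    have : D 0 (h 1 3) + (1 : ℝ) • D 1 (h 1 3) = gaugeFam h 3 + D 0 (h 0 3 + h 1 3)
        + (1 / 2 : ℝ) • D 3 (h 2 2 - h 3 3) - D 2 (h 2 3)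
        + D 3 (h 0 1 + (1 / 2 : ℝ) • h 1 1) - D 3 ((1 / 2 : ℝ) • h 0 0 + h 0 1) := by
      simp only [gaugeFam, map_add, map_sub, map_neg, map_smul, s30, s31, s32]
      module
    rw [this]
    exact sub_mem (add_mem (sub_mem (add_mem (add_mem (hG 3) (hd 0 hb3))
      (Submodule.smul_mem _ _ (hd 3 hc2))) (hd 2 hc3)) (hd 3 hb1)) (hd 3 hb0)
  -- Modulo controlled terms, the gauge equations with index 0 and 1 read `∂_0 w = 2 ∂_0 q + ∂_1 q`
  -- and `∂_0 q = -2 ∂_1 q - ∂_1 w`, hence `∂_0 w = -3 ∂_1 q - 2 ∂_1 w`. The left eigenvectors of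
  -- the resulting matrix are `(σ, 1)` with `σ² = 3` and eigenvalue `2 + σ`.
  have hcomb : ∀ σ : ℝ, σ * σ = 3 → 0 < 2 + σ →
      σ • h 0 1 + (1 / 2 : ℝ) • (h 2 2 + h 3 3) ∈ controlled N T (k + 1) := by
    intro σ hσ hpos
    refine mem_controlled_of_sommerfeld hpos
      (add_mem (Submodule.smul_mem _ _ (H.wave _ _))
        (Submodule.smul_mem _ _ (add_mem (H.wave _ _) (H.wave _ _))))
      (add_mem (Submodule.smul_mem _ _ (H.init _ _))
        (Submodule.smul_mem _ _ (add_mem (H.init _ _) (H.init _ _)))) ?_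
    set P0 := (1 / 2 : ℝ) • h 0 0 + h 0 1 with hP0
    set P1 := h 0 1 + (1 / 2 : ℝ) • h 1 1 with hP1
    have : D 0 (σ • h 0 1 + (1 / 2 : ℝ) • (h 2 2 + h 3 3))
        + (2 + σ) • D 1 (σ • h 0 1 + (1 / 2 : ℝ) • (h 2 2 + h 3 3))
        = (2 + σ) • ((σ - 2) • (gaugeFam h 0 + D 0 P0 + D 0 P1
            - D 2 (h 0 2 + h 1 2) + D 2 (h 1 2) - D 3 (h 0 3 + h 1 3) + D 3 (h 1 3))
          + D 1 P1 + D 1 P0 + D 2 (h 1 2) + D 3 (h 1 3) - gaugeFam h 1)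
          -- Keeping `σ` symbolic leaves this multiple of `σ² - 3`, so that `module` proves a
          -- polynomial identity without square roots.
          + (σ * σ - 3) • (D 0 ((1 / 2 : ℝ) • (h 2 2 + h 3 3)) - (2 : ℝ) • D 0 (h 0 1)) := by
      simp only [hP0, hP1, gaugeFam, map_add, map_neg, map_smul, s10]
      module
    rw [this, hσ, sub_self, zero_smul, add_zero]
    refine Submodule.smul_mem _ _ (sub_mem (add_mem (add_mem (add_mem (add_mem
      (Submodule.smul_mem _ _ ?_) (hd 1 hb1)) (hd 1 hb0)) (hd 2 hQ2)) (hd 3 hQ3)) (hG 1))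
    exact add_mem (sub_mem (add_mem (sub_mem (add_mem (add_mem (hG 0) (hd 0 hb0)) (hd 0 hb1))
      (hd 2 hb2)) (hd 2 hQ2)) (hd 3 hb3)) (hd 3 hQ3)
  have h3 : √3 * √3 = (3 : ℝ) := Real.mul_self_sqrt (by norm_num)
  have h3lt : √3 < (2 : ℝ) := by rw [Real.sqrt_lt' (by norm_num)]; norm_num
  have h3pos : (0 : ℝ) < √3 := by positivity
  have hplus := hcomb (√3) h3 (by positivity)
  have hminus := hcomb (-√3) (by linarith) (by linarith)
  have hq : h 0 1 ∈ controlled N T (k + 1) := by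
    refine (Submodule.smul_mem_iff _ (mul_pos two_pos h3pos).ne').1 ?_
    convert sub_mem hplus hminus using 1
    module
  have hw : (1 / 2 : ℝ) • (h 2 2 + h 3 3) ∈ controlled N T (k + 1) := by
    simpa using sub_mem hplus (Submodule.smul_mem _ (√3) hq)
  refine H.controlled_of_unknowns hq ?_ hw hQ2 hQ3 i j
  have : h 1 1 = (2 : ℝ) • (h 0 1 + (1 / 2 : ℝ) • h 1 1) - (2 : ℝ) • h 0 1 := by module
  rw [this]
  exact sub_mem (Submodule.smul_mem _ _ hb1) (Submodule.smul_mem _ _ hq)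

end GaugedFam

/-! ### The mean curvature problem: reduction to a third order boundary operator -/

lemma D_add_smul_mem_waves {p : SmoothFam ι} (hp : p ∈ waves ι) (r : ℝ) :
    D 0 p + r • D 1 p ∈ waves ι :=
  add_mem (D_mem_waves hp 0) (Submodule.smul_mem _ r (D_mem_waves hp 1))

lemma D_add_smul_mem_initControlled {p : SmoothFam ι} (hp : p ∈ initControlled N T (k + 1))
    (r : ℝ) : D 0 p + r • D 1 p ∈ initControlled N T k :=
  add_mem (D_mem_initControlled hp 0) (Submodule.smul_mem _ r (D_mem_initControlled hp 1))

/-- Estimate for waves `p` with a controlled boundary value of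
`(∂_0 + ∂_1)(∂_0² + 2 a ∂_0 ∂_1 + b ∂_1²) p`. -/
theorem mem_controlled_of_third_order {a b : ℝ} (ha : 0 ≤ a) (hb : 0 < b) (hab : b ≤ a ^ 2)
    {p : SmoothFam ι} (hp : p ∈ waves ι) (hinit : p ∈ initControlled N T (k + 3))
    (hside : D 0 (D 0 (D 0 p) + (2 * a) • D 0 (D 1 p) + b • D 1 (D 1 p))
      + (1 : ℝ) • D 1 (D 0 (D 0 p) + (2 * a) • D 0 (D 1 p) + b • D 1 (D 1 p))
      ∈ sideControlled N T k) : p ∈ controlled N T (k + 3) := by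
  -- The quadratic factor is `(∂_0 + r₁ ∂_1)(∂_0 + r₂ ∂_1)`: `b ≤ a²` makes the speeds real, and `b
  -- > 0` with `a ≥ 0` makes `r₂` positive.
  set r₁ := a + √(a ^ 2 - b)
  set r₂ := a - √(a ^ 2 - b)
  have hsq : √(a ^ 2 - b) ^ 2 = a ^ 2 - b := Real.sq_sqrt (by linarith)
  have hs0 : 0 ≤ √(a ^ 2 - b) := Real.sqrt_nonneg _
  have hlt : √(a ^ 2 - b) < a := by nlinarith
  have hr₁ : 0 < r₁ := by simp only [r₁]; linarith
  have hr₂ : 0 < r₂ := by simp only [r₂]; linarith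
  have hprod : r₁ * r₂ = b := by simp only [r₁, r₂]; linarith
  have hsum : r₁ + r₂ = 2 * a := by simp only [r₁, r₂]; ring
  -- The factors are inverted one at a time, each gaining one order: `k + 1` here, then `k + 2` and
  -- `k + 3`. A bound in `controlled` serves as the boundary datum of the next factor.
  have hY : D 0 (D 0 p) + (2 * a) • D 0 (D 1 p) + b • D 1 (D 1 p) ∈ controlled N T (k + 1) := by
    refine mem_controlled_of_sommerfeld one_pos ?_ ?_ hside
    · exact add_mem (add_mem (D_mem_waves (D_mem_waves hp _) _)
        (Submodule.smul_mem _ _ (D_mem_waves (D_mem_waves hp _) _)))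
        (Submodule.smul_mem _ _ (D_mem_waves (D_mem_waves hp _) _))
    · exact add_mem (add_mem (D_mem_initControlled (D_mem_initControlled hinit _) _)
        (Submodule.smul_mem _ _ (D_mem_initControlled (D_mem_initControlled hinit _) _)))
        (Submodule.smul_mem _ _ (D_mem_initControlled (D_mem_initControlled hinit _) _))
  have hv : D 0 p + r₂ • D 1 p ∈ controlled N T (k + 2) := by
    refine mem_controlled_of_sommerfeld hr₁ (D_add_smul_mem_waves hp _)
      (D_add_smul_mem_initControlled hinit _) (controlled_le_sideControlled ?_)
    convert hY using 1
    rw [← hsum, ← hprod]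
    simp only [map_add, map_smul, D_comm 1 0]
    module
  exact mem_controlled_of_sommerfeld hr₂ hp hinit (controlled_le_sideControlled hv)

/-- Elimination of all unknowns but `p` from the boundary system of the mean curvature problem. -/
lemma third_order_identity (α β : ℝ) (p q w Q₂ Q₃ : SmoothFam ι) :
    let R₁ := D 1 p - D 0 p - D 0 w - D 1 w
    let R₂ := D 0 q + D 1 q + α • D 0 p + β • D 1 p
    let R₃ := D 2 Q₂ + D 3 Q₃ - D 0 q - D 1 q + D 0 p + D 0 w
    let S₂ := D 0 Q₂ + D 1 Q₂ - D 2 (p + q)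
    let S₃ := D 0 Q₃ + D 1 Q₃ - D 3 (p + q)
    let E := D 2 S₂ + D 3 S₃ - D 0 R₃ - D 1 R₃ - D 0 R₁
    let Y := D 0 (D 0 p) + (2 * (α + 1)) • D 0 (D 1 p) + (2 * β - 1) • D 1 (D 1 p)
    D 0 Y + (1 : ℝ) • D 1 Y
      = -D 0 E - D 1 E + D 0 (D 0 R₂) + (2 : ℝ) • D 0 (D 1 R₂) + D 1 (D 1 R₂) - D 2 (D 2 R₂)
        - D 3 (D 3 R₂) + α • D 0 (boxFam p) + β • D 1 (boxFam p)
        - D 0 (boxFam p) - D 1 (boxFam p) := by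
  intro R₁ R₂ R₃ S₂ S₃ E Y
  -- In `E` the terms with `Q₂`, `Q₃` cancel between the `S` and `R₃`, and those with `w` between
  -- `R₃` and `R₁`; only `p` and `q` are left.
  have hE : E = D 0 (D 0 q) + (2 : ℝ) • D 0 (D 1 q) + D 1 (D 1 q) - (2 : ℝ) • D 0 (D 1 p)
      - D 2 (D 2 p) - D 3 (D 3 p) - D 2 (D 2 q) - D 3 (D 3 q) := by
    simp only [E, S₂, S₃, R₁, R₃, map_add, map_sub, D_comm 1 0, D_comm 2 0, D_comm 3 0,
      D_comm 2 1, D_comm 3 1]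
    module
  -- Applying `∂_0 + ∂_1` to `E` allows `(∂_0 + ∂_1) q` to be replaced through `R₂`. The tangential
  -- Laplacian of `p` is then traded for `∂_0² - ∂_1²`, which produces the `boxFam p` terms.
  rw [hE]
  simp only [Y, R₂, boxFam_eq, map_add, map_sub, map_neg, map_smul, D_comm 1 0, D_comm 2 0,
    D_comm 3 0, D_comm 2 1, D_comm 3 1]
  module

namespace GaugedFam

variable {h : Fin 4 → Fin 4 → SmoothFam ι}

/-- The system with a condition on the combination of mean curvatures. -/
theorem controlled_of_meanCurv_system {α β : ℝ} (hα : 0 ≤ α + 1) (hβ : 0 < 2 * β - 1)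
    (hαβ : 2 * β - 1 ≤ (α + 1) ^ 2) (H : GaugedFam N T (k + 2) h)
    (side_H : meanCurvFam α β h ∈ sideControlled N T (k + 2)) (i j : Fin 4) :
    h i j ∈ controlled N T (k + 3) := by
  obtain ⟨hc2, hc3, hb0, hb2, hb3⟩ := H.controlled_of_dirichlet_data
  have s10 := H.symm 1 0
  have s20 := H.symm 2 0
  have s21 := H.symm 2 1
  have s30 := H.symm 3 0
  have s31 := H.symm 3 1
  have s32 := H.symm 3 2
  have dw : ∀ a i j, D a (h i j) ∈ waves ι := fun a i j => D_mem_waves (H.wave i j) a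
  have di : ∀ a i j, D a (h i j) ∈ initControlled N T (k + 2) := fun a i j =>
    D_mem_initControlled (H.init i j) a
  have sm : ∀ {S : Submodule ℝ (SmoothFam ι)} (r : ℝ) {u : SmoothFam ι}, u ∈ S → r • u ∈ S :=
    fun r _ hu => Submodule.smul_mem _ r hu
  -- A combination of first derivatives of `h` with constant coefficients inherits both the wave
  -- equation and the initial bounds.
  have gauge_mem : ∀ (S : Submodule ℝ (SmoothFam ι)), (∀ a i j, D a (h i j) ∈ S) →
      ∀ a, gaugeFam h a ∈ S := by
    intro S hS a
    simp only [gaugeFam, map_add, map_neg]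
    exact sub_mem (add_mem (add_mem (add_mem (neg_mem (hS _ _ _)) (hS _ _ _)) (hS _ _ _))
      (hS _ _ _)) (sm _ (add_mem (add_mem (add_mem (neg_mem (hS _ _ _)) (hS _ _ _)) (hS _ _ _))
      (hS _ _ _)))
  have curv_mem : ∀ (S : Submodule ℝ (SmoothFam ι)), (∀ a i j, D a (h i j) ∈ S) →
      meanCurvFam α β h ∈ S := by
    intro S hS
    simp only [meanCurvFam, map_add]
    exact add_mem (sub_mem
      (sm _ (sub_mem (sub_mem (sm _ (add_mem (hS _ _ _) (hS _ _ _))) (hS _ _ _)) (hS _ _ _)))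
      (sm _ (add_mem (sub_mem (sub_mem (sub_mem (hS _ _ _) (sm _ (hS _ _ _))) (hS _ _ _))
        (hS _ _ _)) (sm _ (add_mem (hS _ _ _) (hS _ _ _))))))
      (sm _ (add_mem (sub_mem (neg_mem (hS _ _ _)) (hS _ _ _))
        (sm _ (add_mem (hS _ _ _) (hS _ _ _)))))
  -- The gauge field and, next, the mean curvature are waves with Dirichlet data. This improves side
  -- bounds to bounds on all derivatives, which is needed since the elimination applies `∂_1` to
  -- these quantities.
  have hG : ∀ a, gaugeFam h a ∈ controlled N T (k + 2) := fun a =>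
    mem_controlled_of_dirichlet (gauge_mem _ dw a) (gauge_mem _ di a)
      (vanishing_openSide_le_sideControlled (H.gauge a))
  have hH : meanCurvFam α β h ∈ controlled N T (k + 2) :=
    mem_controlled_of_dirichlet (curv_mem _ dw) (curv_mem _ di) side_H
  have dc : ∀ {l : ℕ} {u : SmoothFam ι} (i : Fin 4), u ∈ controlled N T (l + 1) →
      D i u ∈ controlled N T l := fun i hu => D_mem_controlled hu i
  set P₀ := (1 / 2 : ℝ) • h 0 0 + h 0 1 with hP₀
  set P₂ := h 0 2 + h 1 2 with hP₂
  set P₃ := h 0 3 + h 1 3 with hP₃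
  set p := (1 / 2 : ℝ) • h 1 1 with hp
  set w := (1 / 2 : ℝ) • (h 2 2 + h 3 3) with hw
  have pw : p ∈ waves ι := sm _ (H.wave _ _)
  have pi : p ∈ initControlled N T (k + 3) := sm _ (H.init _ _)
  -- Boundary system for `p`, `q = h_01`, `w`, `h_12`, `h_13`: `R₁` is the sum of the gauge
  -- equations 0 and 1, `R₂` the mean curvature condition, `R₃` gauge equation 0, and `S₂`, `S₃` are
  -- gauge equations 2 and 3.
  have R₁ : D 1 p - D 0 p - D 0 w - D 1 w ∈ controlled N T (k + 2) := by
    have : D 1 p - D 0 p - D 0 w - D 1 w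
        = gaugeFam h 0 + gaugeFam h 1 + D 0 P₀ - D 1 P₀ - D 2 P₂ - D 3 P₃ := by
      simp only [hp, hw, hP₀, hP₂, hP₃, gaugeFam, map_add, map_neg, map_smul, s10]
      module
    rw [this]
    exact sub_mem (sub_mem (sub_mem (add_mem (add_mem (hG 0) (hG 1)) (dc 0 hb0)) (dc 1 hb0))
      (dc 2 hb2)) (dc 3 hb3)
  have R₂ : D 0 (h 0 1) + D 1 (h 0 1) + α • D 0 p + β • D 1 p ∈ controlled N T (k + 2) := by
    have : D 0 (h 0 1) + D 1 (h 0 1) + α • D 0 p + β • D 1 p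
        = β • (D 1 p - D 0 p - D 0 w - D 1 w) - meanCurvFam α β h - (α + β) • gaugeFam h 0
          - (α • (D 2 P₂ + D 3 P₃) - (α + β + 1) • D 1 P₀
            + (α + β) • (D 0 P₀ - D 2 P₂ - D 3 P₃)) := by
      simp only [hp, hw, hP₀, hP₂, hP₃, gaugeFam, meanCurvFam, map_add, map_neg, map_smul]
      module
    rw [this]
    exact sub_mem (sub_mem (sub_mem (sm _ R₁) hH) (sm _ (hG 0)))
      (add_mem (sub_mem (sm _ (add_mem (dc 2 hb2) (dc 3 hb3))) (sm _ (dc 1 hb0)))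
        (sm _ (sub_mem (sub_mem (dc 0 hb0) (dc 2 hb2)) (dc 3 hb3))))
  have R₃ : D 2 (h 1 2) + D 3 (h 1 3) - D 0 (h 0 1) - D 1 (h 0 1) + D 0 p + D 0 w
      ∈ controlled N T (k + 2) := by
    have : D 2 (h 1 2) + D 3 (h 1 3) - D 0 (h 0 1) - D 1 (h 0 1) + D 0 p + D 0 w
        = D 2 P₂ + D 3 P₃ - D 0 P₀ - gaugeFam h 0 := by
      simp only [hp, hw, hP₀, hP₂, hP₃, gaugeFam, map_add, map_neg, map_smul]
      module
    rw [this]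
    exact sub_mem (sub_mem (add_mem (dc 2 hb2) (dc 3 hb3)) (dc 0 hb0)) (hG 0)
  have S₂ : D 0 (h 1 2) + D 1 (h 1 2) - D 2 (p + h 0 1) ∈ controlled N T (k + 2) := by
    have : D 0 (h 1 2) + D 1 (h 1 2) - D 2 (p + h 0 1)
        = gaugeFam h 2 + D 0 P₂ - (1 / 2 : ℝ) • D 2 (h 2 2 - h 3 3) - D 3 (h 2 3) - D 2 P₀ := by
      simp only [hp, hP₀, hP₂, gaugeFam, map_add, map_sub, map_neg, map_smul, s20, s21]
      module
    rw [this]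
    exact sub_mem (sub_mem (sub_mem (add_mem (hG 2) (dc 0 hb2)) (sm _ (dc 2 hc2))) (dc 3 hc3))
      (dc 2 hb0)
  have S₃ : D 0 (h 1 3) + D 1 (h 1 3) - D 3 (p + h 0 1) ∈ controlled N T (k + 2) := by
    have : D 0 (h 1 3) + D 1 (h 1 3) - D 3 (p + h 0 1)
        = gaugeFam h 3 + D 0 P₃ + (1 / 2 : ℝ) • D 3 (h 2 2 - h 3 3) - D 2 (h 2 3) - D 3 P₀ := by
      simp only [hp, hP₀, hP₃, gaugeFam, map_add, map_sub, map_neg, map_smul, s30, s31, s32]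
      module
    rw [this]
    exact sub_mem (sub_mem (add_mem (add_mem (hG 3) (dc 0 hb3)) (sm _ (dc 3 hc2))) (dc 2 hc3))
      (dc 3 hb0)
  have hpc : p ∈ controlled N T (k + 3) := by
    refine mem_controlled_of_third_order hα hβ hαβ pw pi (controlled_le_sideControlled ?_)
    have hbox : ∀ a, D a (boxFam p) ∈ controlled N T k := fun a =>
      vanishing_corner_le_controlled (D_mem_vanishing_corner pw a)
    have hE := sub_mem (sub_mem (sub_mem (add_mem (dc 2 S₂) (dc 3 S₃)) (dc 0 R₃)) (dc 1 R₃))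
      (dc 0 R₁)
    rw [third_order_identity α β p (h 0 1) w (h 1 2) (h 1 3)]
    exact sub_mem (sub_mem (add_mem (add_mem (sub_mem (sub_mem (add_mem (add_mem (add_mem
      (sub_mem (neg_mem (dc 0 hE)) (dc 1 hE)) (dc 0 (dc 0 R₂))) (sm _ (dc 0 (dc 1 R₂))))
      (dc 1 (dc 1 R₂))) (dc 2 (dc 2 R₂))) (dc 3 (dc 3 R₂))) (sm _ (hbox 0))) (sm _ (hbox 1)))
      (hbox 0)) (hbox 1)
  -- Once `p` is known, `R₁`, `R₂`, `S₂`, `S₃` are Sommerfeld conditions with `r = 1` for `w`,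
  -- `h_01`, `h_12`, `h_13`.
  have hwc : w ∈ controlled N T (k + 3) := by
    refine mem_controlled_of_sommerfeld one_pos (sm _ (add_mem (H.wave _ _) (H.wave _ _)))
      (sm _ (add_mem (H.init _ _) (H.init _ _))) (controlled_le_sideControlled ?_)
    convert sub_mem (sub_mem (dc 1 hpc) (dc 0 hpc)) R₁ using 1
    module
  have hqc : h 0 1 ∈ controlled N T (k + 3) := by
    refine mem_controlled_of_sommerfeld one_pos (H.wave _ _) (H.init _ _)
      (controlled_le_sideControlled ?_)
    convert sub_mem (sub_mem R₂ (sm α (dc 0 hpc))) (sm β (dc 1 hpc)) using 1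
    module
  have hQ2 : h 1 2 ∈ controlled N T (k + 3) := by
    refine mem_controlled_of_sommerfeld one_pos (H.wave _ _) (H.init _ _)
      (controlled_le_sideControlled ?_)
    convert add_mem S₂ (dc 2 (add_mem hpc hqc)) using 1
    module
  have hQ3 : h 1 3 ∈ controlled N T (k + 3) := by
    refine mem_controlled_of_sommerfeld one_pos (H.wave _ _) (H.init _ _)
      (controlled_le_sideControlled ?_)
    convert add_mem S₃ (dc 3 (add_mem hpc hqc)) using 1
    module
  refine H.controlled_of_unknowns hqc ?_ hwc hQ2 hQ3 i j
  exact (Submodule.smul_mem_iff _ (by norm_num : (1 / 2 : ℝ) ≠ 0)).1 hpc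

end GaugedFam

/-! ### The two systems -/

variable {g : ι → MatField}

/-- The components of a family of gauged waves. -/
def componentFam (hg : ∀ e, IsGaugedWave (g e)) (i j : Fin 4) : SmoothFam ι :=
  ⟨fun e x => g e x i j, fun e => (hg e).smooth i j⟩

lemma openSide_subset_corner : openSide ⊆ corner := fun _ hx => ⟨hx.1.le, hx.2.le⟩

lemma pd_symm (hg : ∀ e, IsGaugedWave (g e)) (e : ι) (a i j : Fin 4) :
    pd a (fun y => g e y i j) = pd a (fun y => g e y j i) := by
  congr 1
  funext y
  exact ((hg e).symm y).apply j i

lemma gaugeFam_mem_vanishing (hg : ∀ e, IsGaugedWave (g e)) (a : Fin 4) :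
    gaugeFam (componentFam hg) a ∈ vanishing ι openSide := by
  intro e x hx
  have h0 := (hg e).gauge_side a x (openSide_subset_corner hx) hx.2
  rw [linearization_gaugeField (hg e).smooth] at h0
  simp only [scaledChristoffel_zero] at h0
  simp only [gaugeFam, map_add, map_neg]
  change -pd 0 (fun y => g e y a 0) x + pd 1 (fun y => g e y a 1) x + pd 2 (fun y => g e y a 2) x
    + pd 3 (fun y => g e y a 3) x - 1 / 2 * (-pd a (fun y => g e y 0 0) x
      + pd a (fun y => g e y 1 1) x + pd a (fun y => g e y 2 2) x
      + pd a (fun y => g e y 3 3) x) = 0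
  fin_cases a
  · simp at h0 ⊢; linarith
  all_goals simp at h0 ⊢; linarith

lemma meanCurvFam_eq (hg : ∀ e, IsGaugedWave (g e)) (α β : ℝ) (e : ι) (x : Coord 4) :
    (meanCurvFam α β (componentFam hg)).1 e x = linearization (meanCurv α β) (g e) x := by
  rw [linearization_meanCurv (hg e).smooth]
  simp only [scaledChristoffel_zero]
  simp only [meanCurvFam, map_add]
  change α * (1 / 2 * (pd 0 (fun y => g e y 2 2) x + pd 0 (fun y => g e y 3 3) x)
      - pd 2 (fun y => g e y 0 2) x - pd 3 (fun y => g e y 0 3) x)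
    - (α + β + 1) * (pd 0 (fun y => g e y 0 1) x - 1 / 2 * pd 1 (fun y => g e y 0 0) x
      - pd 2 (fun y => g e y 1 2) x - pd 3 (fun y => g e y 1 3) x
      + 1 / 2 * (pd 1 (fun y => g e y 2 2) x + pd 1 (fun y => g e y 3 3) x))
    + (α + 1) * (-pd 2 (fun y => g e y 1 2) x - pd 3 (fun y => g e y 1 3) x
      + 1 / 2 * (pd 1 (fun y => g e y 2 2) x + pd 1 (fun y => g e y 3 3) x)) = _
  rw [pd_symm hg e 0 0 1]
  simp
  ring

lemma lintegral_jetSq_slice (s : ℕ) (t : ℝ) {u : Coord 4 → ℝ} (hu : ContDiff ℝ ∞ u) :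
    ∫⁻ x, ENNReal.ofReal (jetSq s u x) ∂sliceMeasure t = barNormSqSlice s t u :=
  lintegral_sliceMeasure (continuous_jetSq s hu).measurable.ennreal_ofReal t

lemma lintegral_jetSq_side (s : ℕ) (t : ℝ) {u : Coord 4 → ℝ} (hu : ContDiff ℝ ∞ u) :
    ∫⁻ x, ENNReal.ofReal (jetSq s u x) ∂sideMeasure t = barNormSqSide s t u :=
  lintegral_sideMeasure (continuous_jetSq s hu).measurable.ennreal_ofReal t

lemma gaugedFam_componentFam (hg : ∀ e, IsGaugedWave (g e)) {b₀ b₂ b₃ c₂ c₃ : ι → Coord 3 → ℝ}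
    (hd : ∀ e, HasCommonData (g e) (b₀ e) (b₂ e) (b₃ e) (c₂ e) (c₃ e))
    (hinit : ∀ e t, ∑ i, ∑ j, barNormSqSlice (k + 1) 0 (fun x => g e x i j) ≤ N e t)
    (hb₀ : ∀ e t, normSqSide (k + 1) t (b₀ e) ≤ N e t)
    (hb₂ : ∀ e t, normSqSide (k + 1) t (b₂ e) ≤ N e t)
    (hb₃ : ∀ e t, normSqSide (k + 1) t (b₃ e) ≤ N e t)
    (hc₂ : ∀ e t, normSqSide (k + 1) t (c₂ e) ≤ N e t)
    (hc₃ : ∀ e t, normSqSide (k + 1) t (c₃ e) ≤ N e t) :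
    GaugedFam N T k (componentFam hg) where
  symm i j := by
    ext e x
    exact ((hg e).symm x).apply j i
  wave i j := fun e x hx => (hg e).wave i j x hx
  init i j := by
    refine mem_jets_of_bound fun e t _ _ => ?_
    refine (lintegral_jetSq_slice _ _ ((hg e).smooth i j)).trans_le (le_trans ?_ (hinit e t))
    exact (Finset.single_le_sum (f := fun j => barNormSqSlice (k + 1) 0 fun x => g e x i j)
      (fun _ _ => zero_le) (Finset.mem_univ j)).trans
      (Finset.single_le_sum (f := fun i => ∑ j, barNormSqSlice (k + 1) 0 fun x => g e x i j)
        (fun _ _ => zero_le) (Finset.mem_univ i))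
  gauge := gaugeFam_mem_vanishing hg
  side_c₂ := mem_sideControlled_of_data (fun e t _ _ => hc₂ e t)
    fun e y hy => (hd e).eq_c₂ y hy.le
  side_c₃ := mem_sideControlled_of_data (fun e t _ _ => hc₃ e t)
    fun e y hy => (hd e).eq_c₃ y hy.le
  side_b₀ := mem_sideControlled_of_data (fun e t _ _ => hb₀ e t) fun e y hy => by
    -- The boundary condition is stated with `h_10`, the family with `h_01`.
    rw [← (hd e).eq_b₀ y hy.le, ((hg e).symm (sidePt y)).apply 0 1]
    rfl
  side_b₂ := mem_sideControlled_of_data (fun e t _ _ => hb₂ e t)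
    fun e y hy => (hd e).eq_b₂ y hy.le
  side_b₃ := mem_sideControlled_of_data (fun e t _ _ => hb₃ e t)
    fun e y hy => (hd e).eq_b₃ y hy.le

/-- Control of all components in the form of the energy estimate. -/
lemma exists_energy_estimate (hg : ∀ e, IsGaugedWave (g e))
    (hc : ∀ i j, componentFam hg i j ∈ controlled N T k) :
    ∃ c C : ℝ≥0, 0 < c ∧ 0 < C ∧ ∀ e t, 0 ≤ t → t ≤ T →
      (∑ i, ∑ j, barNormSqSlice k t (fun x => g e x i j))
        + (c : ℝ≥0∞) * ∑ i, ∑ j, barNormSqSide k t (fun x => g e x i j) ≤ C * N e t := by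
  choose A hA using fun i j => exists_bound_jetSq (jets_mono le_rfl inf_le_left (hc i j))
  choose B hB using fun i j => exists_bound_jetSq (jets_mono le_rfl inf_le_right (hc i j))
  -- Slices and side are bounded separately, so `c = 1` works; the summand 1 in `C` only makes it
  -- positive.
  refine ⟨1, ∑ i, ∑ j, A i j + ∑ i, ∑ j, B i j + 1, one_pos, by positivity,
    fun e t ht hT => ?_⟩
  have h1 : ∑ i, ∑ j, barNormSqSlice k t (fun x => g e x i j) ≤ ∑ i, ∑ j, A i j * N e t := by
    refine Finset.sum_le_sum fun i _ => Finset.sum_le_sum fun j _ => ?_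
    rw [← lintegral_jetSq_slice k t ((hg e).smooth i j)]
    exact hA i j e t ht hT
  have h2 : ∑ i, ∑ j, barNormSqSide k t (fun x => g e x i j) ≤ ∑ i, ∑ j, B i j * N e t := by
    refine Finset.sum_le_sum fun i _ => Finset.sum_le_sum fun j _ => ?_
    rw [← lintegral_jetSq_side k t ((hg e).smooth i j)]
    exact hB i j e t ht hT
  simp only [← Finset.sum_mul] at h1 h2
  rw [ENNReal.coe_one, one_mul]
  refine (add_le_add h1 h2).trans ?_
  rw [← add_mul]
  push_cast
  gcongr ?_ * _
  exact le_self_add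

/-- The energy estimate for the system with Dirichlet, conformal and gauge conditions. -/
theorem dirichlet_energy_estimate (k : ℕ) (T : ℝ) :
    ∃ c C : ℝ≥0, 0 < c ∧ 0 < C ∧
      ∀ (h : MatField) (b₀ b₁ b₂ b₃ c₂ c₃ : Coord 3 → ℝ),
        IsDirichletSolution h b₀ b₁ b₂ b₃ c₂ c₃ → ∀ t : ℝ, 0 ≤ t → t ≤ T →
          (∑ i, ∑ j, barNormSqSlice (k + 1) t (fun x => h x i j))
            + (c : ℝ≥0∞) * ∑ i, ∑ j, barNormSqSide (k + 1) t (fun x => h x i j)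
          ≤ (C : ℝ≥0∞) *
            ((∑ i, ∑ j, barNormSqSlice (k + 1) 0 (fun x => h x i j))
              + (normSqSide (k + 1) t b₀ + normSqSide (k + 1) t b₁
                + normSqSide (k + 1) t b₂ + normSqSide (k + 1) t b₃)
              + (normSqSide (k + 1) t c₂ + normSqSide (k + 1) t c₃)) := by
  -- The index runs over all solutions together with their data, so a constant for this one family
  -- is a constant uniform in `h`.
  let ι := {d : MatField × (Fin 6 → Coord 3 → ℝ) //
    IsDirichletSolution d.1 (d.2 0) (d.2 1) (d.2 2) (d.2 3) (d.2 4) (d.2 5)}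
  let N : ι → ℝ → ℝ≥0∞ := fun e t =>
    (∑ i, ∑ j, barNormSqSlice (k + 1) 0 (fun x => e.1.1 x i j))
      + (normSqSide (k + 1) t (e.1.2 0) + normSqSide (k + 1) t (e.1.2 1)
        + normSqSide (k + 1) t (e.1.2 2) + normSqSide (k + 1) t (e.1.2 3))
      + (normSqSide (k + 1) t (e.1.2 4) + normSqSide (k + 1) t (e.1.2 5))
  have hg : ∀ e : ι, IsGaugedWave e.1.1 := fun e => e.2.gauged
  have H : GaugedFam N T k (componentFam hg) := by
    refine gaugedFam_componentFam hg (fun e => e.2.common) ?_ ?_ ?_ ?_ ?_ ?_ <;> intro e t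
    · exact le_add_right le_self_add
    · exact le_add_right (le_add_left (le_add_right (le_add_right le_self_add)))
    · exact le_add_right (le_add_left (le_add_right le_add_self))
    · exact le_add_right (le_add_left le_add_self)
    · exact le_add_left le_self_add
    · exact le_add_left le_add_self
  have side_b₁ : componentFam hg 0 1 + (1 / 2 : ℝ) • componentFam hg 1 1
      ∈ sideControlled N T (k + 1) := by
    refine mem_sideControlled_of_data (b := fun e => e.1.2 1) (fun e t _ _ => ?_)
      fun e y hy => e.2.eq_b₁ y hy.le
    exact le_add_right (le_add_left (le_add_right (le_add_right le_add_self)))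
  obtain ⟨c, C, hc, hC, hle⟩ :=
    exists_energy_estimate hg (H.controlled_of_dirichlet_system side_b₁)
  exact ⟨c, C, hc, hC, fun h b₀ b₁ b₂ b₃ c₂ c₃ hh t ht hT =>
    hle ⟨(h, ![b₀, b₁, b₂, b₃, c₂, c₃]), hh⟩ t ht hT⟩

/-- The energy estimate for the system with a condition on the combination of mean curvatures. -/
theorem meanCurv_energy_estimate (k : ℕ) (T : ℝ) {α β : ℝ} (hα : 0 ≤ α + 1)
    (hβ : 0 < 2 * β - 1) (hαβ : 2 * β - 1 ≤ (α + 1) ^ 2) :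
    ∃ c C : ℝ≥0, 0 < c ∧ 0 < C ∧
      ∀ (h : MatField) (H b₀ b₂ b₃ c₂ c₃ : Coord 3 → ℝ),
        IsMeanCurvSolution α β h H b₀ b₂ b₃ c₂ c₃ → ∀ t : ℝ, 0 ≤ t → t ≤ T →
          (∑ i, ∑ j, barNormSqSlice (k + 3) t (fun x => h x i j))
            + (c : ℝ≥0∞) * ∑ i, ∑ j, barNormSqSide (k + 3) t (fun x => h x i j)
          ≤ (C : ℝ≥0∞) *
            ((∑ i, ∑ j, barNormSqSlice (k + 3) 0 (fun x => h x i j))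
              + normSqSide (k + 2) t H
              + (normSqSide (k + 3) t b₀ + normSqSide (k + 3) t b₂ + normSqSide (k + 3) t b₃)
              + (normSqSide (k + 3) t c₂ + normSqSide (k + 3) t c₃)) := by
  let ι := {d : MatField × (Fin 6 → Coord 3 → ℝ) //
    IsMeanCurvSolution α β d.1 (d.2 0) (d.2 1) (d.2 2) (d.2 3) (d.2 4) (d.2 5)}
  let N : ι → ℝ → ℝ≥0∞ := fun e t =>
    (∑ i, ∑ j, barNormSqSlice (k + 3) 0 (fun x => e.1.1 x i j))
      + normSqSide (k + 2) t (e.1.2 0)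
      + (normSqSide (k + 3) t (e.1.2 1) + normSqSide (k + 3) t (e.1.2 2)
        + normSqSide (k + 3) t (e.1.2 3))
      + (normSqSide (k + 3) t (e.1.2 4) + normSqSide (k + 3) t (e.1.2 5))
  have hg : ∀ e : ι, IsGaugedWave e.1.1 := fun e => e.2.gauged
  have H : GaugedFam N T (k + 2) (componentFam hg) := by
    refine gaugedFam_componentFam hg (fun e => e.2.common) ?_ ?_ ?_ ?_ ?_ ?_ <;> intro e t
    · exact le_add_right (le_add_right le_self_add)
    · exact le_add_right (le_add_left (le_add_right le_self_add))
    · exact le_add_right (le_add_left (le_add_right le_add_self))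
    · exact le_add_right (le_add_left le_add_self)
    · exact le_add_left le_self_add
    · exact le_add_left le_add_self
  have side_H : meanCurvFam α β (componentFam hg) ∈ sideControlled N T (k + 2) := by
    refine mem_sideControlled_of_data (b := fun e => e.1.2 0) (fun e t _ _ => ?_)
      fun e y hy => (meanCurvFam_eq hg α β e _).trans (e.2.eq_H y hy.le)
    exact le_add_right (le_add_right le_add_self)
  obtain ⟨c, C, hc, hC, hle⟩ :=
    exists_energy_estimate hg (H.controlled_of_meanCurv_system hα hβ hαβ side_H)
  exact ⟨c, C, hc, hC, fun h H b₀ b₂ b₃ c₂ c₃ hh t ht hT =>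
    hle ⟨(h, ![H, b₀, b₂, b₃, c₂, c₃]), hh⟩ t ht hT⟩

lemma exists_eq_add_three {s : ℕ} (hs : (5 / 2 : ℝ) < (s : ℝ)) : ∃ k, s = k + 3 := by
  have h2 : 2 < s := by
    have : (2 : ℝ) < s := by linarith
    exact_mod_cast this
  exact ⟨s - 3, by omega⟩

end CornerIBVP

end

theorem proposition3p3 :
    (∀ s : ℕ, (5 / 2 : ℝ) < (s : ℝ) → ∀ T : ℝ, 0 < T →
      ∃ c C : ℝ≥0, 0 < c ∧ 0 < C ∧
        ∀ (h : CornerIBVP.MatField) (b₀ b₁ b₂ b₃ c₂ c₃ : CornerIBVP.Coord 3 → ℝ),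
          CornerIBVP.IsDirichletSolution h b₀ b₁ b₂ b₃ c₂ c₃ →
          ∀ t : ℝ, 0 ≤ t → t ≤ T →
            (∑ i, ∑ j, CornerIBVP.barNormSqSlice s t (fun x => h x i j))
              + (c : ℝ≥0∞) * ∑ i, ∑ j, CornerIBVP.barNormSqSide s t (fun x => h x i j)
            ≤ (C : ℝ≥0∞) *
              ((∑ i, ∑ j, CornerIBVP.barNormSqSlice s 0 (fun x => h x i j))
                + (CornerIBVP.normSqSide s t b₀ + CornerIBVP.normSqSide s t b₁
                  + CornerIBVP.normSqSide s t b₂ + CornerIBVP.normSqSide s t b₃)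
                + (CornerIBVP.normSqSide s t c₂ + CornerIBVP.normSqSide s t c₃)))
    ∧
    (∀ s : ℕ, (5 / 2 : ℝ) < (s : ℝ) → ∀ T : ℝ, 0 < T →
      ∀ α β : ℝ, 0 ≤ α + 1 → 0 < 2 * β - 1 → 2 * β - 1 ≤ (α + 1) ^ 2 →
      ∃ c C : ℝ≥0, 0 < c ∧ 0 < C ∧
        ∀ (h : CornerIBVP.MatField) (H b₀ b₂ b₃ c₂ c₃ : CornerIBVP.Coord 3 → ℝ),
          CornerIBVP.IsMeanCurvSolution α β h H b₀ b₂ b₃ c₂ c₃ →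
          ∀ t : ℝ, 0 ≤ t → t ≤ T →
            (∑ i, ∑ j, CornerIBVP.barNormSqSlice s t (fun x => h x i j))
              + (c : ℝ≥0∞) * ∑ i, ∑ j, CornerIBVP.barNormSqSide s t (fun x => h x i j)
            ≤ (C : ℝ≥0∞) *
              ((∑ i, ∑ j, CornerIBVP.barNormSqSlice s 0 (fun x => h x i j))
                + CornerIBVP.normSqSide (s - 1) t H
                + (CornerIBVP.normSqSide s t b₀
                  + CornerIBVP.normSqSide s t b₂ + CornerIBVP.normSqSide s t b₃)
                + (CornerIBVP.normSqSide s t c₂ + CornerIBVP.normSqSide s t c₃))) := by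
  constructor
  · intro s hs T _
    obtain ⟨k, rfl⟩ := CornerIBVP.exists_eq_add_three hs
    exact CornerIBVP.dirichlet_energy_estimate (k + 2) T
  · intro s hs T _ α β hα hβ hαβ
    obtain ⟨k, rfl⟩ := CornerIBVP.exists_eq_add_three hs
    -- With `s = k + 3`, the order `s - 1` of the norm of `H` is `k + 2` by definitional unfolding.
    exact CornerIBVP.meanCurv_energy_estimate k T hα hβ hαβ
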